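/- Let $F$ be a non-archimedean local field with ring of integers $\mathcal O$, maximal ideal $\mathfrak p=(\varpi)$, residue field $\mathcal O/\mathfrak p$ of order $q$ and absolute value $|\cdot|$ normalized by $|\varpi|=q^{-1}$. Let $n\ge 1$, $G=GL_n(F)$, let $N\subset G$ be the group of upper triangular unipotent matrices, and let $J\subset GL_n(\mathcal O)$ be the Iwahori subgroup, the preimage of the upper triangular subgroup of $GL_n(\mathcal O/\mathfrak p)$. For $\bar k\in\mathbb Z^n$ put $\varpi^{\bar k}=\mathrm{diag}(\varpi^{k_1},\dots,\varpi^{k_n})$ and $\delta_B(\varpi^{\bar k})=\prod_{i=1}^n|\varpi^{k_i}|^{n+1-2i}$. Identify the Weyl group $\mathbf W\cong S_n$ with the permutation matrices ($we_j=e_{w(j)}$), with simple reflections $s_i=(i\ \,i+1)$, $1\le i\le n-1$, and let $\ell$ be the length (least number of simple reflections with product $w$). Let $u\in G$ be the matrix with $u_{i,i+1}=1$ for $1\le i\le n-1$, $u_{n,1}=\varpi$ and all other entries $0$. For $g\in G$ let $X_g$ act on right $J$-invariant functions $f:G\to\mathbb C$ by $(X_gf)(x)=\int_{JgJ}f(xh)\,dh$,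 where $dh$ is the Haar measure with $\mathrm{vol}(J)=1$. Let $\psi:F\to\mathbb C^\times$ be an additive character that is trivial on $\mathcal O$ but not on $\mathfrak p^{-1}$, and put $\psi(\nu)=\psi\bigl(\sum_{i=1}^{n-1}\nu_{i,i+1}\bigr)$ for $\nu\in N$. Let $\epsilon\in\mathbb C$ and let $W:G\to\mathbb C$ satisfy: $W(\nu g)=\psi(\nu)W(g)$ for $\nu\in N$; $W(gj)=W(g)$ for $j\in J$; $W(zg)=W(g)$ for every scalar matrix $z\in G$; $W(1)=1$; $X_{s_i}W=-W$ for $1\le i\le n-1$; and $X_uW=\epsilon W$. Call $\bar k\in\mathbb Z^n$ $w$-dominant if for every $1\le i\le n-1$ one has $k_i-k_{i+1}\ge 0$ when $w^{-1}(i)<w^{-1}(i+1)$ and $k_i-k_{i+1}\ge -1$ when $w^{-1}(i)>w^{-1}(i+1)$. Then for all $\bar k\in\mathbb Z^n$ and $w\in\mathbf W$, with $d=\varpi^{\bar k}$, $$W(dw)=\begin{cases}\epsilon^{\sum_i k_i}\,(-1)^{(n-1)\sum_i k_i}\,\delta_B(d)\,(-q)^{-\ell(w)} & \text{if } \bar k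 \text{ is } w\text{-dominant},\\ 0 & \text{otherwise.}\end{cases}$$ Moreover every $g\in G$ can be written as $g=\nu\,\varpi^{\bar k}\,w\,j$ with $\nu\in N$, $\bar k\in\mathbb Z^n$, $w\in\mathbf W$, $j\in J$, and $W$ is determined completely: it is the only function $G\to\mathbb C$ with the properties listed above (for the given $\epsilon$ and $\psi$). -/

import Mathlib

open ValuativeRel MeasureTheory
open scoped Matrix MatrixGroups

noncomputable section

namespace IwahoriWhittaker

/-! ### The local field -/

section Field

variable (F : Type*) [Field F] [ValuativeRel F] [TopologicalSpace F]
  [IsNonarchimedeanLocalField F]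

/-- The number `q` of elements of the residue field `𝒪 / 𝔭`. -/
def resCard : ℕ := Nat.card 𝓀[F]

variable {F}

/-- The standard absolute value `|x| = q ^ (-v(x))`, where `v` is the valuation with value group
`ℤ`. Mathlib writes valuations multiplicatively, so that the logarithm below is `-v(x)`. -/
def stdAbs (x : F) : ℝ :=
  open Classical in
  if x = 0 then 0 else
    (resCard F : ℝ) ^
      (WithZero.log (IsNonarchimedeanLocalField.valueGroupWithZeroIsoInt F (valuation F x)))

/-- `ϖ` is a uniformizer: it generates the maximal ideal of `𝒪`. -/
def IsUnif (ϖ : Fˣ) : Prop :=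
  ∃ h : (ϖ : F) ∈ 𝒪[F], 𝓂[F] = Ideal.span {(⟨(ϖ : F), h⟩ : 𝒪[F])}

/-- An additive character is unramified if it is trivial on `𝒪` but not on `𝔭⁻¹ = ϖ⁻¹ 𝒪`. -/
def IsUnramifiedChar (ϖ : Fˣ) (ψ : AddChar F ℂ) : Prop :=
  (∀ x ∈ 𝒪[F], ψ x = 1) ∧ ∃ x ∈ 𝒪[F], ψ ((ϖ : F)⁻¹ * x) ≠ 1

end Field

/-! ### Subgroups and elements of `GL_n` -/

section Group

variable {n : ℕ}

/-- The upper triangular Borel subgroup of `GL_n(R)`. -/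
def borelSubgroup (n : ℕ) (R : Type*) [CommRing R] : Subgroup (GL (Fin n) R) where
  carrier := {g | ∀ i j : Fin n, j < i → (g : Matrix (Fin n) (Fin n) R) i j = 0}
  one_mem' := fun _ _ hij => Matrix.one_apply_ne hij.ne'
  mul_mem' := by
    intro a b ha hb
    have ha' : Matrix.BlockTriangular (a : Matrix (Fin n) (Fin n) R) id := fun i j h => ha i j h
    have hb' : Matrix.BlockTriangular (b : Matrix (Fin n) (Fin n) R) id := fun i j h => hb i j h
    exact fun i j h => ha'.mul hb' h
  inv_mem' := by
    intro a ha
    have ha' : Matrix.BlockTriangular (a : Matrix (Fin n) (Fin n) R) id := fun i j h => ha i j h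
    let _ : Invertible (a : Matrix (Fin n) (Fin n) R) := a.invertible
    have h := Matrix.blockTriangular_inv_of_blockTriangular ha'
    intro i j hij
    rw [Matrix.coe_units_inv]
    exact h hij

/-- `g` lies in the group `N` of upper triangular unipotent matrices. -/
def IsUnipotentUpper {R : Type*} [CommRing R] (g : GL (Fin n) R) : Prop :=
  (∀ i j : Fin n, j < i → (g : Matrix (Fin n) (Fin n) R) i j = 0) ∧
    ∀ i : Fin n, (g : Matrix (Fin n) (Fin n) R) i i = 1

/-- The diagonal matrix `d(t₁, …, tₙ)`. -/
def torusElt {R : Type*} [CommRing R] (t : Fin n → Rˣ) : GL (Fin n) R where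
  val := Matrix.diagonal fun i => (t i : R)
  inv := Matrix.diagonal fun i => ((t i)⁻¹ : Rˣ)
  val_inv := by simp [Matrix.diagonal_mul_diagonal]
  inv_val := by simp [Matrix.diagonal_mul_diagonal]

/-- The diagonal matrix `ϖ^k = d(ϖ^{k₁}, …, ϖ^{kₙ})`. -/
def unifPow {R : Type*} [CommRing R] (ϖ : Rˣ) (k : Fin n → ℤ) : GL (Fin n) R :=
  torusElt fun i => ϖ ^ k i

/-- The permutation matrix of `w`, with `w e_j = e_{w(j)}`; this is multiplicative in `w`. -/
def weylElt (R : Type*) [CommRing R] (w : Equiv.Perm (Fin n)) : GL (Fin n) R :=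
  (Matrix.permMatrixHom (n := Fin n) (R := R)).toHomUnits w

theorem weylElt_apply (R : Type*) [CommRing R] (w : Equiv.Perm (Fin n)) (i j : Fin n) :
    (weylElt R w : Matrix (Fin n) (Fin n) R) i j = if i = w j then 1 else 0 := by
  change (w⁻¹).permMatrix R i j = _
  simp [PEquiv.toMatrix_apply, Equiv.toPEquiv_apply, Equiv.symm_apply_eq]

/-- The simple reflections `s_i = (i  i+1)` of the Weyl group. -/
def IsSimpleRefl (s : Equiv.Perm (Fin n)) : Prop :=
  ∃ i j : Fin n, (i : ℕ) + 1 = j ∧ s = Equiv.swap i j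

/-- The length of `w`: the least number of factors in an expression of `w` as a product of simple
reflections. -/
def weylLength (w : Equiv.Perm (Fin n)) : ℕ :=
  sInf {m | ∃ l : List (Equiv.Perm (Fin n)),
    l.length = m ∧ (∀ s ∈ l, IsSimpleRefl s) ∧ l.prod = w}

/-- The matrix `u`, with `1`s directly above the diagonal, `ϖ` in the lower left corner and zeroes
elsewhere. -/
def uElt {R : Type*} [CommRing R] (ϖ : Rˣ) : GL (Fin n) R where
  val := Matrix.of fun i j : Fin n =>
    if (i : ℕ) + 1 = j then 1 else if (i : ℕ) + 1 = n ∧ (j : ℕ) = 0 then (ϖ : R) else 0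
  inv := Matrix.of fun i j : Fin n =>
    if (j : ℕ) + 1 = i then 1 else if (j : ℕ) + 1 = n ∧ (i : ℕ) = 0 then ((ϖ⁻¹ : Rˣ) : R) else 0
  val_inv := by
    ext i k
    rw [Matrix.mul_apply, Matrix.one_apply]
    by_cases hi : (i : ℕ) + 1 < n
    · rw [Finset.sum_eq_single (⟨i + 1, hi⟩ : Fin n)]
      · simp only [Matrix.of_apply, if_true, one_mul, Fin.ext_iff]
        grind
      · intro l _ hl
        have : (i : ℕ) + 1 ≠ l := fun h => hl (Fin.ext h.symm)
        simp [this, hi.ne]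
      · simp
    · have hi' : (i : ℕ) + 1 = n := by omega
      have h0 : 0 < n := by omega
      rw [Finset.sum_eq_single (⟨0, h0⟩ : Fin n)]
      · simp only [Matrix.of_apply, Fin.ext_iff]
        have := k.isLt
        by_cases hk : (k : ℕ) + 1 = n
        · have : (i : ℕ) = k := by omega
          simp [hk, this, h0.ne']
        · have : (i : ℕ) ≠ k := by omega
          simp [hk, this]
      · intro l _ hl
        have h1 : (l : ℕ) ≠ 0 := fun h => hl (Fin.ext h)
        have h2 : (i : ℕ) + 1 ≠ l := by omega
        simp [h1, h2]
      · simp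
  inv_val := by
    ext i k
    rw [Matrix.mul_apply, Matrix.one_apply]
    have hin := i.isLt
    have hkn := k.isLt
    by_cases hi : (i : ℕ) = 0
    · rw [Finset.sum_eq_single (⟨n - 1, by omega⟩ : Fin n)]
      · have h1 : n - 1 + 1 = n := by omega
        have h2 : n ≠ (k : ℕ) := by omega
        by_cases hk : (k : ℕ) = 0
        · simp [hi, h1, hk, Fin.ext_iff, show n ≠ 0 by omega]
        · simp [hi, h1, hk, h2, Fin.ext_iff, Ne.symm hk]
      · intro l _ hl
        have h1 : (l : ℕ) + 1 ≠ n := fun h => hl (Fin.ext (by simp; omega))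
        simp [hi, h1]
      · simp
    · rw [Finset.sum_eq_single (⟨i - 1, by omega⟩ : Fin n)]
      · have h1 : (i : ℕ) - 1 + 1 = i := by omega
        simp [h1, hin.ne, Fin.ext_iff]
      · intro l _ hl
        have h1 : (l : ℕ) + 1 ≠ i := fun h => hl (Fin.ext (by simp; omega))
        simp [hi, h1]
      · simp

/-- The weight `k` is `w`-dominant: for every simple root `α = α_{i,i+1}`, `⟨α, k⟩ ≥ 0` if
`w⁻¹ α = α_{w⁻¹(i),w⁻¹(i+1)}` is positive and `⟨α, k⟩ ≥ -1` if it is negative. -/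
def IsDominant (w : Equiv.Perm (Fin n)) (k : Fin n → ℤ) : Prop :=
  ∀ i j : Fin n, (i : ℕ) + 1 = j →
    (w⁻¹ i < w⁻¹ j → 0 ≤ k i - k j) ∧ (w⁻¹ j < w⁻¹ i → -1 ≤ k i - k j)

end Group

/-! ### Iwahori subgroup, Hecke operators and Whittaker functions -/

section Iwahori

variable (n : ℕ) (F : Type*) [Field F] [ValuativeRel F] [TopologicalSpace F]
  [IsNonarchimedeanLocalField F]

/-- The Iwahori subgroup `J`: the preimage of the Borel subgroup of `GL_n(𝒪/𝔭)` in
`K = GL_n(𝒪)`, viewed inside `GL_n(F)`. -/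
def iwahori : Subgroup (GL (Fin n) F) :=
  ((borelSubgroup n 𝓀[F]).comap
    (Matrix.GeneralLinearGroup.map (n := Fin n) (IsLocalRing.residue 𝒪[F]))).map
      (Matrix.GeneralLinearGroup.map (n := Fin n) (algebraMap 𝒪[F] F))

variable {n F}

/-- The modular character of the Borel subgroup on the diagonal torus,
`δ_B(d(t₁, …, tₙ)) = |t₁|^{n-1} |t₂|^{n-3} ⋯ |tₙ|^{1-n}` (here `i` counts from `0`). -/
def deltaB (t : Fin n → Fˣ) : ℝ :=
  ∏ i : Fin n, stdAbs (t i : F) ^ ((n : ℤ) - 1 - 2 * (i : ℤ))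

/-- The action of the characteristic function `X_g` of `J g J` on functions on `GL_n(F)`:
`(X_g f)(x) = ∫_{JgJ} f(xh) dh`. -/
def heckeOp [MeasurableSpace (GL (Fin n) F)] (μ : Measure (GL (Fin n) F)) (g : GL (Fin n) F)
    (f : GL (Fin n) F → ℂ) (x : GL (Fin n) F) : ℂ :=
  ∫ h in DoubleCoset.doubleCoset g (iwahori n F : Set (GL (Fin n) F)) (iwahori n F), f (x * h) ∂μ

/-- The character of `N` attached to `ψ`, `ν ↦ ψ(ν_{1,2} + ν_{2,3} + ⋯ + ν_{n-1,n})`. -/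
def unipChar (ψ : AddChar F ℂ) (ν : GL (Fin n) F) : ℂ :=
  ψ (∑ i : Fin n, ∑ j : Fin n,
    if (i : ℕ) + 1 = j then (ν : Matrix (Fin n) (Fin n) F) i j else 0)

/-- The functions `W` on `GL_n(F)` under consideration. -/
structure IsSteinbergWhittaker [MeasurableSpace (GL (Fin n) F)] (μ : Measure (GL (Fin n) F))
    (ϖ : Fˣ) (ψ : AddChar F ℂ) (ε : ℂ) (W : GL (Fin n) F → ℂ) : Prop where
  /-- `W` is an `(N, ψ)`-Whittaker function. -/
  whittaker : ∀ ν g : GL (Fin n) F, IsUnipotentUpper ν → W (ν * g) = unipChar ψ ν * W g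
  /-- `W` is right `J`-invariant. -/
  iwahori_inv : ∀ g j : GL (Fin n) F, j ∈ iwahori n F → W (g * j) = W g
  /-- `W` is invariant under the centre of `GL_n(F)`. -/
  center_inv : ∀ (z : Fˣ) (g : GL (Fin n) F),
    W (Matrix.GeneralLinearGroup.scalar (Fin n) z * g) = W g
  /-- `W` is normalized. -/
  map_one : W 1 = 1
  /-- `X_{s_i}` acts on `W` by `-1` for the simple reflections `s_1, …, s_{n-1}`. -/
  hecke_simple : ∀ s : Equiv.Perm (Fin n), IsSimpleRefl s →
    ∀ g : GL (Fin n) F, heckeOp μ (weylElt F s) W g = -W g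
  /-- `X_u` acts on `W` by `ε`. -/
  hecke_u : ∀ g : GL (Fin n) F, heckeOp μ (uElt ϖ) W g = ε * W g

end Iwahori

end IwahoriWhittaker

end

/-! Gaussian elimination gives `G = ⋃ N ϖ^k w J` (`exists_eq_mul_unifPow_mul_weylElt_mul`), so by
equivariance `W` is known once its values on the pairs `(k, w)` are. Computing these values
therefore yields the formula and the uniqueness at once.

For a non-dominant pair, some root element of `J` passes across `ϖ^k w` to a simple root element of
`N` on which `ψ` is not `1`, and the value must vanish (`eq_zero_of_not_isDominant`).

Two moves relate the other values. If `w i < w j` for adjacent `i, j`, the `q` cosets in `J s J`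
contribute equally at a dominant pair, so passing from `w` to `w s` divides the value by `-q`
(`resCard_mul_apply_mul_swap`). Since `u` normalizes `J`, right translation by `u` multiplies values
by `ε`; it adds `1` to one coordinate of `k` and rotates `w` (`apply_add_single`).

The combinatorial core, `eq_of_isDominant`, is that these moves connect all dominant pairs: for
fixed `k` one climbs to the longest element, and there `u` allows `k` to change one coordinate at a
time. The claimed formula `dominantValue` obeys the same two relations, so its ratio to `W` is
constant, and normalization makes it `1`. Counting inversions controls the length under both moves.
-/

namespace IwahoriWhittaker

/-! ### Valuations of powers of a uniformizer. -/

section Valuation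

variable {F : Type*} [Field F] [ValuativeRel F] [TopologicalSpace F]
  [IsNonarchimedeanLocalField F] {ϖ : Fˣ}

theorem residue_eq_zero_iff_valuation_lt_one (x : 𝒪[F]) :
    IsLocalRing.residue 𝒪[F] x = 0 ↔ valuation F (x : F) < 1 := by
  rw [IsLocalRing.residue_eq_zero_iff, IsLocalRing.mem_maximalIdeal, mem_nonunits_iff]
  exact Valuation.Integer.not_isUnit_iff_valuation_lt_one

theorem IsUnif.valuation_lt_one (hϖ : IsUnif ϖ) : valuation F (ϖ : F) < 1 := by
  obtain ⟨h, hm⟩ := hϖ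
  rw [← residue_eq_zero_iff_valuation_lt_one ⟨(ϖ : F), h⟩, IsLocalRing.residue_eq_zero_iff, hm]
  exact Ideal.mem_span_singleton_self _

theorem IsUnif.valuation_le_of_lt_one (hϖ : IsUnif ϖ) {x : F} (hx : valuation F x < 1) :
    valuation F x ≤ valuation F (ϖ : F) := by
  obtain ⟨h, hm⟩ := hϖ
  have hx' : (⟨x, hx.le⟩ : 𝒪[F]) ∈ 𝓂[F] := by
    rw [← IsLocalRing.residue_eq_zero_iff, residue_eq_zero_iff_valuation_lt_one]
    exact hx
  rw [hm, Ideal.mem_span_singleton] at hx'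
  exact (Valuation.integer.integers (valuation F)).le_of_dvd hx'

omit [TopologicalSpace F] [IsNonarchimedeanLocalField F] in
theorem valuation_unif_ne_zero : valuation F (ϖ : F) ≠ 0 :=
  (Valuation.ne_zero_iff _).2 ϖ.ne_zero

open WithZero in
-- Discreteness gives one inequality: anything below `1` is at most `exp (-1)`. For the other, an
-- element of value `exp (-1)` lies in the maximal ideal, hence is a multiple of `ϖ`.
theorem IsUnif.valueGroupWithZeroIsoInt_valuation (hϖ : IsUnif ϖ) :
    IsNonarchimedeanLocalField.valueGroupWithZeroIsoInt F (valuation F (ϖ : F)) = exp (-1) := by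
  set e := IsNonarchimedeanLocalField.valueGroupWithZeroIsoInt F
  have he1 : e 1 = 1 := map_one e
  apply le_antisymm
  · have h : e (valuation F (ϖ : F)) < 1 := by
      rw [← he1]
      exact e.strictMono hϖ.valuation_lt_one
    have h0 : e (valuation F (ϖ : F)) ≠ 0 := by
      simp
    rw [← WithZero.exp_log h0] at h ⊢
    rw [← WithZero.exp_zero, WithZero.exp_lt_exp] at h
    rw [WithZero.exp_le_exp]
    omega
  · obtain ⟨y, hy⟩ := ValuativeRel.valuation_surjective (e.symm (exp (-1)))
    have hy1 : valuation F y < 1 := by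
      apply e.strictMono.lt_iff_lt.1
      rw [hy, he1, OrderMonoidIso.apply_symm_apply, ← WithZero.exp_zero, WithZero.exp_lt_exp]
      omega
    have := e.strictMono.monotone (hϖ.valuation_le_of_lt_one hy1)
    rwa [hy, OrderMonoidIso.apply_symm_apply] at this

theorem IsUnif.exists_valuation_eq_zpow (hϖ : IsUnif ϖ) {x : F} (hx : x ≠ 0) :
    ∃ m : ℤ, valuation F x = valuation F ((ϖ ^ m : Fˣ) : F) := by
  set e := IsNonarchimedeanLocalField.valueGroupWithZeroIsoInt F with he
  have h0 : e (valuation F x) ≠ 0 := by simpa using hx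
  refine ⟨-WithZero.log (e (valuation F x)), e.injective ?_⟩
  change e _ = e _
  rw [Units.val_zpow_eq_zpow_val, map_zpow₀, map_zpow₀, he, hϖ.valueGroupWithZeroIsoInt_valuation,
    ← he, ← WithZero.exp_zsmul]
  simp [WithZero.exp_log h0]

theorem IsUnif.stdAbs_zpow (hϖ : IsUnif ϖ) (m : ℤ) :
    stdAbs ((ϖ ^ m : Fˣ) : F) = (resCard F : ℝ) ^ (-m) := by
  rw [stdAbs, if_neg (Units.ne_zero _), Units.val_zpow_eq_zpow_val, map_zpow₀, map_zpow₀,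
    hϖ.valueGroupWithZeroIsoInt_valuation, ← WithZero.exp_zsmul, WithZero.log_exp]
  simp

theorem IsUnif.valuation_zpow_le_one (hϖ : IsUnif ϖ) {m : ℤ} (hm : 0 ≤ m) :
    valuation F ((ϖ ^ m : Fˣ) : F) ≤ 1 := by
  lift m to ℕ using hm
  rw [zpow_natCast, Units.val_pow_eq_pow_val, map_pow]
  exact pow_le_one₀ zero_le hϖ.valuation_lt_one.le

theorem IsUnif.valuation_zpow_lt_one (hϖ : IsUnif ϖ) {m : ℤ} (hm : 0 < m) :
    valuation F ((ϖ ^ m : Fˣ) : F) < 1 := by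
  lift m to ℕ using hm.le
  rw [zpow_natCast, Units.val_pow_eq_pow_val, map_pow]
  exact pow_lt_one₀ zero_le hϖ.valuation_lt_one (by omega)

theorem IsUnif.valuation_inv_mul_le_one (hϖ : IsUnif ϖ) {x : F} (hx : valuation F x < 1) :
    valuation F ((ϖ : F)⁻¹ * x) ≤ 1 := by
  rw [map_mul, map_inv₀, inv_mul_le_iff₀ (zero_lt_iff.2 valuation_unif_ne_zero), mul_one]
  exact hϖ.valuation_le_of_lt_one hx

theorem resCard_ne_zero : resCard F ≠ 0 := Nat.card_pos.ne'

end Valuation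

/-! ### The Iwahori subgroup entrywise, and Hecke operators as finite coset sums. -/

section Iwahori

variable {n : ℕ} {F : Type*} [Field F] [ValuativeRel F] [TopologicalSpace F]
  [IsNonarchimedeanLocalField F]

theorem mem_iwahori_iff (g : GL (Fin n) F) : g ∈ iwahori n F ↔
    (∀ i j, valuation F (g i j) ≤ 1) ∧ (∀ i j, j < i → valuation F (g i j) < 1) ∧
      ∀ i, valuation F (g i i) = 1 := by
  constructor
  · rintro ⟨h, hh, rfl⟩
    have hlow : ∀ i j, j < i → IsLocalRing.residue 𝒪[F] (h i j) = 0 := hh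
    have hval : ∀ i j, (Matrix.GeneralLinearGroup.map (algebraMap 𝒪[F] F) h) i j = (h i j : F) :=
      fun _ _ => rfl
    simp only [hval]
    refine ⟨fun i j => (h i j).2, fun i j hij => ?_, fun i => ?_⟩
    · exact (residue_eq_zero_iff_valuation_lt_one _).1 (hlow i j hij)
    · have hdet := (Matrix.isUnit_iff_isUnit_det _).1
        (Matrix.GeneralLinearGroup.map (IsLocalRing.residue 𝒪[F]) h).isUnit
      rw [Matrix.det_of_isUpperTriangular
        (M := (Matrix.GeneralLinearGroup.map (IsLocalRing.residue 𝒪[F]) h).1)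
        (fun i j hij => hlow i j hij), isUnit_iff_ne_zero,
        Finset.prod_ne_zero_iff] at hdet
      refine le_antisymm (h i i).2 (not_lt.1 fun hlt => hdet i (Finset.mem_univ _) ?_)
      exact (residue_eq_zero_iff_valuation_lt_one _).2 hlt
  · rintro ⟨hint, hlow, hdiag⟩
    let A : Matrix (Fin n) (Fin n) 𝒪[F] := Matrix.of fun i j => ⟨g i j, hint i j⟩
    have hA : ∀ i j, j < i → (A.map (IsLocalRing.residue 𝒪[F])) i j = 0 := fun i j hij =>
      (residue_eq_zero_iff_valuation_lt_one _).2 (hlow i j hij)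
    -- Modulo the maximal ideal the matrix is triangular with nonzero diagonal, so its determinant
    -- is a unit of the local ring.
    have hdet : IsUnit A.det := by
      apply (IsLocalRing.residue_ne_zero_iff_isUnit _).1
      rw [RingHom.map_det, RingHom.mapMatrix_apply,
        Matrix.det_of_isUpperTriangular (fun i j hij => hA i j hij), Finset.prod_ne_zero_iff]
      intro i _ h0
      have := (residue_eq_zero_iff_valuation_lt_one (A i i)).1 h0
      exact this.ne (hdiag i)
    refine ⟨Matrix.GeneralLinearGroup.mk'' A hdet, fun i j hij => hA i j hij, ?_⟩
    ext i j
    rfl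

theorem isOpen_iwahori : IsOpen (iwahori n F : Set (GL (Fin n) F)) := by
  have hentry : ∀ i j, Continuous fun g : GL (Fin n) F => g i j := fun i j =>
    Continuous.matrix_elem Units.continuous_val i j
  have hset : (iwahori n F : Set (GL (Fin n) F)) =
      (⋂ i, ⋂ j, {g | valuation F (g i j) ≤ 1}) ∩
        ((⋂ i, ⋂ j, ⋂ _ : j < i, {g | valuation F (g i j) < 1}) ∩
          ⋂ i, {g | valuation F (g i i) = 1}) := by
    ext g
    simp [mem_iwahori_iff]
  have h1 : IsOpen {x : F | valuation F x ≤ 1} :=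
    Valuation.isOpen_integer (v := valuation F)
  have h2 : IsOpen {x : F | valuation F x < 1} := by
    simpa using Valuation.isOpen_ball (v := valuation F) 1
  have h3 : IsOpen {x : F | valuation F x = 1} := by
    simpa using Valuation.isOpen_sphere (v := valuation F) one_ne_zero
  rw [hset]
  refine .inter (isOpen_iInter_of_finite fun i => isOpen_iInter_of_finite fun j =>
      h1.preimage (hentry i j)) (.inter (isOpen_iInter_of_finite fun i =>
      isOpen_iInter_of_finite fun j => isOpen_iInter_of_finite fun _ => h2.preimage (hentry i j))
      (isOpen_iInter_of_finite fun i => h3.preimage (hentry i i)))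

section Hecke

variable [MeasurableSpace (GL (Fin n) F)] [BorelSpace (GL (Fin n) F)]
  (μ : Measure (GL (Fin n) F)) [μ.IsHaarMeasure]

theorem measurableSet_smul_iwahori (g : GL (Fin n) F) :
    MeasurableSet ((g * ·) '' (iwahori n F : Set (GL (Fin n) F))) :=
  ((Homeomorph.mulLeft g).isOpenMap _ isOpen_iwahori).measurableSet

variable {μ} in
theorem integrableOn_smul_iwahori (hμ : μ (iwahori n F : Set (GL (Fin n) F)) = 1)
    {W : GL (Fin n) F → ℂ} (hW : ∀ g j : GL (Fin n) F, j ∈ iwahori n F → W (g * j) = W g)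
    (x g : GL (Fin n) F) :
    IntegrableOn (fun h => W (x * h)) ((g * ·) '' (iwahori n F : Set (GL (Fin n) F))) μ := by
  have : IntegrableOn (fun _ => W (x * g))
      ((g * ·) '' (iwahori n F : Set (GL (Fin n) F))) μ :=
    integrableOn_const (by simp [hμ])
  refine this.congr_fun ?_ (measurableSet_smul_iwahori g)
  rintro _ ⟨j, hj, rfl⟩
  simp [← mul_assoc, hW _ j hj]

variable {μ} in
theorem setIntegral_smul_iwahori (hμ : μ (iwahori n F : Set (GL (Fin n) F)) = 1)
    {W : GL (Fin n) F → ℂ} (hW : ∀ g j : GL (Fin n) F, j ∈ iwahori n F → W (g * j) = W g)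
    (x g : GL (Fin n) F) :
    ∫ h in (g * ·) '' (iwahori n F : Set (GL (Fin n) F)), W (x * h) ∂μ = W (x * g) := by
  rw [setIntegral_congr_fun (g := fun _ => W (x * g)) (measurableSet_smul_iwahori g)]
  · simp [Measure.real, hμ]
  · rintro _ ⟨j, hj, rfl⟩
    simp [← mul_assoc, hW _ j hj]

variable {μ} in
/-- If `J g J` is the disjoint union of the cosets `r a J`, then `X_g W (x)` is the sum of the
values `W (x * r a)`. -/
theorem heckeOp_eq_sum (hμ : μ (iwahori n F : Set (GL (Fin n) F)) = 1)
    {W : GL (Fin n) F → ℂ} (hW : ∀ g j : GL (Fin n) F, j ∈ iwahori n F → W (g * j) = W g)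
    {ι : Type*} [Fintype ι] (r : ι → GL (Fin n) F) (g : GL (Fin n) F)
    (hmem : ∀ a, r a ∈ DoubleCoset.doubleCoset g (iwahori n F : Set (GL (Fin n) F)) (iwahori n F))
    (hcover : ∀ j ∈ iwahori n F, ∃ a, (r a)⁻¹ * j * g ∈ iwahori n F)
    (hinj : ∀ a b, (r a)⁻¹ * r b ∈ iwahori n F → a = b) (x : GL (Fin n) F) :
    heckeOp μ g W x = ∑ a, W (x * r a) := by
  have hset : DoubleCoset.doubleCoset g (iwahori n F : Set (GL (Fin n) F)) (iwahori n F) =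
      ⋃ a, (r a * ·) '' (iwahori n F : Set (GL (Fin n) F)) := by
    ext h
    rw [Set.mem_iUnion, DoubleCoset.mem_doubleCoset]
    constructor
    · rintro ⟨j, hj, j', hj', rfl⟩
      obtain ⟨a, ha⟩ := hcover j hj
      exact ⟨a, (r a)⁻¹ * j * g * j', mul_mem ha hj', by simp [mul_assoc]⟩
    · rintro ⟨a, j, hj, rfl⟩
      obtain ⟨j₁, h₁, j₂, h₂, he⟩ := (DoubleCoset.mem_doubleCoset).1 (hmem a)
      exact ⟨j₁, h₁, j₂ * j, mul_mem h₂ hj, by simp [he, mul_assoc]⟩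
  rw [heckeOp, hset, integral_iUnion_fintype (fun a => measurableSet_smul_iwahori _) ?_
    (fun a => integrableOn_smul_iwahori hμ hW x _)]
  · exact Finset.sum_congr rfl fun a _ => setIntegral_smul_iwahori hμ hW x _
  · intro a b hab
    refine Set.disjoint_left.2 ?_
    rintro _ ⟨j, hj, rfl⟩ ⟨j', hj', he⟩
    refine hab (hinj a b ?_)
    have : (r a)⁻¹ * r b = j * j'⁻¹ := by
      have he' : r b * j' = r a * j := he
      rw [inv_mul_eq_iff_eq_mul, ← mul_assoc, ← he', mul_inv_cancel_right]
    rw [this]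
    exact mul_mem hj (inv_mem hj')

end Hecke

end Iwahori

/-! ### Calculus of torus, Weyl and root elements. -/

section Monomial

variable {n : ℕ} {F : Type*} [Field F]

theorem unifPow_mul_apply (ϖ : Fˣ) (k : Fin n → ℤ) (g : GL (Fin n) F) (i j : Fin n) :
    (unifPow ϖ k * g) i j = ((ϖ ^ k i : Fˣ) : F) * g i j := by
  change (Matrix.diagonal (fun i => ((ϖ ^ k i : Fˣ) : F)) * g.1) i j = _
  rw [Matrix.diagonal_mul]

theorem mul_unifPow_apply (ϖ : Fˣ) (k : Fin n → ℤ) (g : GL (Fin n) F) (i j : Fin n) :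
    (g * unifPow ϖ k) i j = g i j * ((ϖ ^ k j : Fˣ) : F) := by
  change (g.1 * Matrix.diagonal fun i => ((ϖ ^ k i : Fˣ) : F)) i j = _
  rw [Matrix.mul_diagonal]

theorem weylElt_mul_apply (w : Equiv.Perm (Fin n)) (g : GL (Fin n) F) (i j : Fin n) :
    (weylElt F w * g) i j = g (w⁻¹ i) j := by
  rw [Units.val_mul, Matrix.mul_apply, Finset.sum_eq_single (w⁻¹ i)]
  · simp [weylElt_apply]
  · intro b _ hb
    have : i ≠ w b := fun h => hb (by simp [h])
    simp [weylElt_apply, this]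
  · simp

theorem mul_weylElt_apply (w : Equiv.Perm (Fin n)) (g : GL (Fin n) F) (i j : Fin n) :
    (g * weylElt F w) i j = g i (w j) := by
  rw [Units.val_mul, Matrix.mul_apply, Finset.sum_eq_single (w j)]
  · simp [weylElt_apply]
  · intro b _ hb
    simp [weylElt_apply, hb]
  · simp

theorem unifPow_zero (ϖ : Fˣ) : unifPow ϖ (0 : Fin n → ℤ) = 1 := by
  ext i j
  simp [unifPow, torusElt]

theorem unifPow_mul_unifPow (ϖ : Fˣ) (k l : Fin n → ℤ) :
    unifPow ϖ k * unifPow ϖ l = unifPow ϖ (k + l) := by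
  ext i j
  rw [unifPow_mul_apply]
  by_cases h : i = j <;> simp [unifPow, torusElt, h, zpow_add]

theorem weylElt_mul (v w : Equiv.Perm (Fin n)) : weylElt F v * weylElt F w = weylElt F (v * w) :=
  (map_mul _ _ _).symm

theorem weylElt_one : weylElt F (1 : Equiv.Perm (Fin n)) = 1 := map_one _

theorem weylElt_mul_unifPow (ϖ : Fˣ) (w : Equiv.Perm (Fin n)) (k : Fin n → ℤ) :
    weylElt F w * unifPow ϖ k = unifPow ϖ (fun i => k (w⁻¹ i)) * weylElt F w := by
  ext i j
  rw [mul_unifPow_apply, unifPow_mul_apply, weylElt_apply]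
  by_cases h : i = w j <;> simp [h]

theorem unifPow_mul_weylElt_conj_apply (ϖ : Fˣ) (k : Fin n → ℤ) (w : Equiv.Perm (Fin n))
    (g : GL (Fin n) F) (p q : Fin n) :
    ((unifPow ϖ k * weylElt F w)⁻¹ * g * (unifPow ϖ k * weylElt F w)) p q =
      ((ϖ ^ (k (w q) - k (w p)) : Fˣ) : F) * g (w p) (w q) := by
  set h := (unifPow ϖ k * weylElt F w)⁻¹ * g * (unifPow ϖ k * weylElt F w) with hh
  -- Clearing the inverse leaves products whose entry at `(w p, q)` is explicit on both sides.
  have key : unifPow ϖ k * (weylElt F w * h) = g * unifPow ϖ k * weylElt F w := by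
    rw [hh]
    group
  have := congrArg (fun x : GL (Fin n) F => x (w p) q) key
  simp only [unifPow_mul_apply, weylElt_mul_apply, mul_weylElt_apply, mul_unifPow_apply] at this
  rw [show w⁻¹ (w p) = p by simp] at this
  change h p q = _
  have hne : ((ϖ ^ k (w p) : Fˣ) : F) ≠ 0 := Units.ne_zero _
  rw [← mul_right_inj' hne, this, ← mul_assoc, ← Units.val_mul, ← zpow_add, add_sub_cancel,
    mul_comm]

theorem weylElt_conj_apply (w : Equiv.Perm (Fin n)) (g : GL (Fin n) F) (p q : Fin n) :
    ((weylElt F w)⁻¹ * g * weylElt F w) p q = g (w p) (w q) := by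
  have := unifPow_mul_weylElt_conj_apply 1 0 w g p q
  simpa [unifPow_zero] using this

/-- The elementary unipotent matrix `1 + a E_{i,j}`. -/
def rootElt {i j : Fin n} (hij : i ≠ j) (a : F) : GL (Fin n) F where
  val := Matrix.transvection i j a
  inv := Matrix.transvection i j (-a)
  val_inv := by simp [Matrix.transvection_mul_transvection_same _ _ hij]
  inv_val := by simp [Matrix.transvection_mul_transvection_same _ _ hij]

theorem rootElt_apply {i j : Fin n} (hij : i ≠ j) (a : F) (p q : Fin n) :
    rootElt hij a p q = (if p = q then 1 else 0) + if p = i ∧ q = j then a else 0 := by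
  simp [rootElt, Matrix.transvection, Matrix.one_apply, Matrix.single_apply, eq_comm]

theorem rootElt_inv {i j : Fin n} (hij : i ≠ j) (a : F) :
    (rootElt hij a)⁻¹ = rootElt hij (-a) := by
  ext p q
  rfl

theorem rootElt_mul_rootElt {i j : Fin n} (hij : i ≠ j) (a b : F) :
    rootElt hij a * rootElt hij b = rootElt hij (a + b) :=
  Units.ext (Matrix.transvection_mul_transvection_same _ _ hij _ _)

theorem rootElt_mul_apply_same {i j : Fin n} (hij : i ≠ j) (a : F) (g : GL (Fin n) F)
    (q : Fin n) : (rootElt hij a * g) i q = g i q + a * g j q := by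
  change (Matrix.transvection i j a * g.1) i q = _
  simp

theorem isUnipotentUpper_rootElt {i j : Fin n} (hij : i < j) (a : F) :
    IsUnipotentUpper (rootElt hij.ne a) := by
  refine ⟨fun p q hpq => ?_, fun p => ?_⟩
  · rw [rootElt_apply, if_neg hpq.ne', if_neg (by rintro ⟨rfl, rfl⟩; exact hij.asymm hpq), add_zero]
  · rw [rootElt_apply, if_pos rfl, if_neg (by rintro ⟨rfl, rfl⟩; exact hij.ne rfl), add_zero]

theorem unipChar_rootElt (ψ : AddChar F ℂ) {i j : Fin n} (hij : i < j) (a : F) :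
    unipChar ψ (rootElt hij.ne a) = ψ (if (i : ℕ) + 1 = j then a else 0) := by
  rw [unipChar]
  congr 1
  rw [Finset.sum_eq_single i, Finset.sum_eq_single j]
  · simp [rootElt_apply, hij.ne]
  · intro b _ hb
    have : (i : ℕ) + 1 = b → i ≠ b := by rintro h rfl; omega
    simp +contextual [rootElt_apply, this, hb]
  · simp
  · intro b _ hb
    refine Finset.sum_eq_zero fun c _ => ?_
    have : (b : ℕ) + 1 = c → b ≠ c := by rintro h rfl; omega
    simp +contextual [rootElt_apply, this, hb]
  · simp

theorem unifPow_mul_weylElt_mul_rootElt (ϖ : Fˣ) (k : Fin n → ℤ) (w : Equiv.Perm (Fin n))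
    {i j : Fin n} (hij : i ≠ j) (a : F) :
    unifPow ϖ k * weylElt F w * rootElt hij a =
      rootElt (w.injective.ne hij) (((ϖ ^ (k (w i) - k (w j)) : Fˣ) : F) * a) *
        (unifPow ϖ k * weylElt F w) := by
  ext p q
  rw [← mul_assoc, mul_weylElt_apply, mul_unifPow_apply, mul_assoc, unifPow_mul_apply,
    weylElt_mul_apply, rootElt_apply, rootElt_apply]
  obtain ⟨p, rfl⟩ := w.surjective p
  rw [show w⁻¹ (w p) = p by simp]
  simp only [w.injective.eq_iff]
  by_cases hpq : p = q
  · subst hpq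
    have : ¬ (p = i ∧ p = j) := by rintro ⟨rfl, rfl⟩; exact hij rfl
    simp [this]
  · by_cases h : p = i ∧ q = j
    · obtain ⟨rfl, rfl⟩ := h
      rw [sub_eq_add_neg, zpow_add, zpow_neg, Units.val_mul, Units.val_inv_eq_inv_val]
      simp [hpq]
      field_simp
    · simp [hpq, h]

end Monomial

/-! ### Coset representatives for the simple reflections and for `u`. -/

section LocalField

variable {n : ℕ} {F : Type*} [Field F] [ValuativeRel F] [TopologicalSpace F]
  [IsNonarchimedeanLocalField F] {ϖ : Fˣ}

theorem rootElt_mem_iwahori_of_lt {i j : Fin n} (hij : i < j) {a : F} (ha : valuation F a ≤ 1) :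
    rootElt hij.ne a ∈ iwahori n F := by
  refine (mem_iwahori_iff _).2 ⟨fun p q => ?_, fun p q hpq => ?_, fun p => ?_⟩
  · rw [rootElt_apply]
    refine (Valuation.map_add _ _ _).trans (max_le ?_ ?_) <;> split_ifs <;> simp [ha]
  · rw [(isUnipotentUpper_rootElt hij a).1 p q hpq]
    simp
  · rw [(isUnipotentUpper_rootElt hij a).2 p]
    simp

theorem rootElt_mem_iwahori_of_gt {i j : Fin n} (hij : j < i) {a : F} (ha : valuation F a < 1) :
    rootElt hij.ne' a ∈ iwahori n F := by
  refine (mem_iwahori_iff _).2 ⟨fun p q => ?_, fun p q hpq => ?_, fun p => ?_⟩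
  · rw [rootElt_apply]
    refine (Valuation.map_add _ _ _).trans (max_le ?_ ?_) <;> split_ifs <;> simp [ha.le]
  · rw [rootElt_apply, if_neg hpq.ne', zero_add]
    split_ifs <;> simp [ha]
  · rw [rootElt_apply, if_pos rfl, if_neg (by rintro ⟨rfl, rfl⟩; exact hij.ne rfl), add_zero]
    simp

omit [ValuativeRel F] [TopologicalSpace F] [IsNonarchimedeanLocalField F] in
/-- `n - 1 ↦ n - 2 ↦ ⋯ ↦ 0 ↦ n - 1`, the permutation underlying `uElt`. -/
theorem uElt_eq {N : ℕ} (ϖ : Fˣ) : (uElt ϖ : GL (Fin (N + 1)) F) =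
    unifPow ϖ (Pi.single (Fin.last N) 1) * weylElt F (finRotate (N + 1))⁻¹ := by
  ext i j
  rw [unifPow_mul_apply, weylElt_apply]
  have hc : i = (finRotate (N + 1))⁻¹ j ↔ finRotate (N + 1) i = j := by
    rw [Equiv.Perm.eq_inv_iff_eq]
  simp only [hc]
  change (if (i : ℕ) + 1 = j then (1 : F) else if (i : ℕ) + 1 = N + 1 ∧ (j : ℕ) = 0 then (ϖ : F)
    else 0) = _
  rcases Fin.eq_castSucc_or_eq_last i with ⟨i, rfl⟩ | rfl
  · have h1 : (Pi.single (Fin.last N) 1 : Fin (N + 1) → ℤ) i.castSucc = 0 :=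
      Pi.single_eq_of_ne i.castSucc_ne_last _
    have h2 : finRotate (N + 1) i.castSucc = i.succ := by
      rw [finRotate_apply, Fin.coeSucc_eq_succ]
    have := i.isLt
    rw [h1, h2, if_neg (show ¬ ((i.castSucc : ℕ) + 1 = N + 1 ∧ (j : ℕ) = 0) by simp; omega)]
    by_cases h : i.succ = j
    · simp [← h]
    · have : ¬ (i.castSucc : ℕ) + 1 = j := fun h' => h (Fin.ext (by simpa using h'))
      simpa [h] using this
  · have := j.isLt
    rw [finRotate_last, if_neg (by rw [Fin.val_last]; omega)]
    by_cases h : (0 : Fin (N + 1)) = j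
    · simp [← h]
    · have : ¬ (j : ℕ) = 0 := fun h' => h (Fin.ext (by simpa using h'.symm))
      simp [h, this]

theorem finRotate_inv_zero (N : ℕ) : (finRotate (N + 1))⁻¹ 0 = Fin.last N := by
  rw [Equiv.Perm.inv_eq_iff_eq, finRotate_last]

theorem finRotate_inv_succ {N : ℕ} (i : Fin N) :
    (finRotate (N + 1))⁻¹ i.succ = i.castSucc := by
  rw [Equiv.Perm.inv_eq_iff_eq, finRotate_apply, Fin.coeSucc_eq_succ]

/-- Conjugation by `u` shifts indices cyclically. Only the wrap-around matters: the last row, in the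
maximal ideal off the diagonal, is divided by `ϖ` and becomes the first row, while the last column
is multiplied by `ϖ` and becomes the first column. -/
theorem uElt_inv_mul_mul_mem {N : ℕ} (hϖ : IsUnif ϖ) {g : GL (Fin (N + 1)) F}
    (hg : g ∈ iwahori (N + 1) F) : (uElt ϖ)⁻¹ * g * uElt ϖ ∈ iwahori (N + 1) F := by
  obtain ⟨hint, hlow, hdiag⟩ := (mem_iwahori_iff g).1 hg
  rw [uElt_eq]
  have hs : ∀ i : Fin N, (Pi.single (Fin.last N) 1 : Fin (N + 1) → ℤ) i.castSucc = 0 := fun i =>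
      Pi.single_eq_of_ne i.castSucc_ne_last _
  have hϖ1 := hϖ.valuation_lt_one
  rw [mem_iwahori_iff]
  simp only [unifPow_mul_weylElt_conj_apply]
  refine ⟨fun p q => ?_, fun p q hpq => ?_, fun p => ?_⟩
  · cases p using Fin.cases with
    | zero =>
      cases q using Fin.cases with
      | zero => simpa using hint _ _
      | succ q =>
        rw [finRotate_inv_zero, finRotate_inv_succ, hs]
        simpa using hϖ.valuation_inv_mul_le_one (hlow _ _ q.castSucc_lt_last)
    | succ p =>
      cases q using Fin.cases with
      | zero =>
        rw [finRotate_inv_zero, finRotate_inv_succ, hs]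
        simpa using mul_le_one' hϖ1.le (hint _ _)
      | succ q =>
        rw [finRotate_inv_succ, finRotate_inv_succ, hs, hs]
        simpa using hint _ _
  · cases p using Fin.cases with
    | zero => exact absurd hpq (Fin.not_lt_zero _)
    | succ p =>
      cases q using Fin.cases with
      | zero =>
        rw [finRotate_inv_zero, finRotate_inv_succ, hs]
        simpa using mul_lt_one_of_lt_of_le hϖ1 (hint _ _)
      | succ q =>
        rw [finRotate_inv_succ, finRotate_inv_succ, hs, hs]
        simpa using hlow _ _ (by simpa using hpq)
  · simpa using hdiag _

/-- A section of the residue map. -/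
noncomputable def residueLift (a : 𝓀[F]) : 𝒪[F] :=
  Function.surjInv (IsLocalRing.residue_surjective (R := 𝒪[F])) a

theorem residue_residueLift (a : 𝓀[F]) : IsLocalRing.residue 𝒪[F] (residueLift a) = a :=
  Function.surjInv_eq _ a

theorem swap_lt_swap_of_lt {i j : Fin n} (hij : (i : ℕ) + 1 = j) {p q : Fin n} (hqp : q < p)
    (h : ¬ (p = j ∧ q = i)) : Equiv.swap i j q < Equiv.swap i j p := by
  simp only [Equiv.swap_apply_def, Fin.ext_iff, Fin.lt_def] at *
  split_ifs <;> omega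

section Hecke

variable [MeasurableSpace (GL (Fin n) F)] [BorelSpace (GL (Fin n) F)]
  {μ : Measure (GL (Fin n) F)} [μ.IsHaarMeasure]
  (hμ : μ (iwahori n F : Set (GL (Fin n) F)) = 1)
  {W : GL (Fin n) F → ℂ} (hW : ∀ g j : GL (Fin n) F, j ∈ iwahori n F → W (g * j) = W g)

include hμ hW

/-- Conjugation by `s` moves just one entry from above the diagonal to below it, the one at `(i,
j)`. An element of `J` thus stays in `J` exactly when this entry reduces to zero, and the residue
field indexes the cosets. -/
theorem heckeOp_swap {i j : Fin n} (hij : (i : ℕ) + 1 = j) [Fintype 𝓀[F]] (x : GL (Fin n) F) :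
    heckeOp μ (weylElt F (Equiv.swap i j)) W x =
      ∑ a : 𝓀[F], W (x * (rootElt (show i < j from Fin.lt_def.2 (by omega)).ne
        (residueLift a : F) * weylElt F (Equiv.swap i j))) := by
  have hlt : i < j := Fin.lt_def.2 (by omega)
  refine heckeOp_eq_sum hμ hW _ _ (fun a => ?_) (fun g hg => ?_) (fun a b hab => ?_) x
  · exact DoubleCoset.mem_doubleCoset.2
      ⟨_, rootElt_mem_iwahori_of_lt hlt (residueLift a).2, 1, one_mem _, by simp⟩
  · obtain ⟨hint, hlow, hdiag⟩ := (mem_iwahori_iff g).1 hg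
    -- The multiple of row `j` to subtract from row `i` so that the entry at `(i, j)` vanishes
    -- modulo the maximal ideal.
    let a : 𝓀[F] := IsLocalRing.residue 𝒪[F] ⟨g i j, hint i j⟩ *
      (IsLocalRing.residue 𝒪[F] ⟨g j j, hint j j⟩)⁻¹
    refine ⟨a, ?_⟩
    have hm : (rootElt hlt.ne (residueLift a : F))⁻¹ * g ∈ iwahori n F :=
      mul_mem (inv_mem (rootElt_mem_iwahori_of_lt hlt (residueLift a).2)) hg
    set m := (rootElt hlt.ne (residueLift a : F))⁻¹ * g with hmdef
    have hmij : valuation F (m i j) < 1 := by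
      have hjj : IsLocalRing.residue 𝒪[F] ⟨g j j, hint j j⟩ ≠ 0 := by
        rw [Ne, residue_eq_zero_iff_valuation_lt_one]
        exact (hdiag j).not_lt
      have : m i j = ((⟨g i j, hint i j⟩ - residueLift a * ⟨g j j, hint j j⟩ : 𝒪[F]) : F) := by
        rw [hmdef, rootElt_inv, rootElt_mul_apply_same]
        push_cast
        ring
      rw [this, ← residue_eq_zero_iff_valuation_lt_one, map_sub, map_mul, residue_residueLift]
      simp [a, hjj]
    have hre : (rootElt hlt.ne (residueLift a : F) * weylElt F (Equiv.swap i j))⁻¹ * g *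
        weylElt F (Equiv.swap i j) =
        (weylElt F (Equiv.swap i j))⁻¹ * m * weylElt F (Equiv.swap i j) := by
      rw [hmdef]; group
    rw [hre]
    obtain ⟨hint, hlow, hdiag⟩ := (mem_iwahori_iff m).1 hm
    rw [mem_iwahori_iff]
    simp only [weylElt_conj_apply]
    refine ⟨fun p q => hint _ _, fun p q hpq => ?_, fun p => hdiag _⟩
    by_cases h : p = j ∧ q = i
    · simpa [h.1, h.2] using hmij
    · exact hlow _ _ (swap_lt_swap_of_lt hij hpq h)
  · have hre : (rootElt hlt.ne (residueLift a : F) * weylElt F (Equiv.swap i j))⁻¹ *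
        (rootElt hlt.ne (residueLift b : F) * weylElt F (Equiv.swap i j)) =
        (weylElt F (Equiv.swap i j))⁻¹ *
          rootElt hlt.ne (((residueLift b - residueLift a : 𝒪[F]) : F)) *
          weylElt F (Equiv.swap i j) := by
      rw [mul_inv_rev, rootElt_inv, mul_assoc, ← mul_assoc (rootElt _ _), rootElt_mul_rootElt,
        ← mul_assoc]
      push_cast
      rw [neg_add_eq_sub]
    rw [hre] at hab
    have := ((mem_iwahori_iff _).1 hab).2.1 j i hlt
    rw [weylElt_conj_apply, Equiv.swap_apply_left, Equiv.swap_apply_right, rootElt_apply,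
      if_neg hlt.ne, if_pos ⟨rfl, rfl⟩, zero_add, ← residue_eq_zero_iff_valuation_lt_one, map_sub,
      residue_residueLift, residue_residueLift, sub_eq_zero] at this
    exact this.symm

end Hecke

theorem heckeOp_uElt {N : ℕ} [MeasurableSpace (GL (Fin (N + 1)) F)]
    [BorelSpace (GL (Fin (N + 1)) F)] {μ : Measure (GL (Fin (N + 1)) F)} [μ.IsHaarMeasure]
    (hμ : μ (iwahori (N + 1) F : Set (GL (Fin (N + 1)) F)) = 1)
    {W : GL (Fin (N + 1)) F → ℂ}
    (hW : ∀ g j : GL (Fin (N + 1)) F, j ∈ iwahori (N + 1) F → W (g * j) = W g)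
    (hϖ : IsUnif ϖ) (x : GL (Fin (N + 1)) F) :
    heckeOp μ (uElt ϖ) W x = W (x * uElt ϖ) := by
  rw [heckeOp_eq_sum hμ hW (fun _ : Unit => uElt ϖ) (uElt ϖ)
    (fun _ => DoubleCoset.mem_doubleCoset.2 ⟨1, one_mem _, 1, one_mem _, by simp⟩)
    (fun j hj => ⟨(), uElt_inv_mul_mul_mem hϖ hj⟩) (fun _ _ _ => rfl)]
  simp

end LocalField

/-! ### Length as the number of inversions. -/

section Length

variable {n : ℕ}

/-- The number of inversions of a permutation. -/
def inversionCount (w : Equiv.Perm (Fin n)) : ℕ :=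
  ∑ p, ∑ q, if p < q ∧ w q < w p then 1 else 0

theorem swap_lt_swap_iff {i j : Fin n} (hij : (i : ℕ) + 1 = j) {p q : Fin n}
    (h₁ : ¬ (p = i ∧ q = j)) (h₂ : ¬ (p = j ∧ q = i)) :
    Equiv.swap i j p < Equiv.swap i j q ↔ p < q := by
  refine ⟨fun h => ?_, fun h => swap_lt_swap_of_lt hij h (by tauto)⟩
  by_contra hpq
  rcases (not_lt.1 hpq).eq_or_lt with rfl | hlt
  · exact lt_irrefl _ h
  · exact h.asymm (swap_lt_swap_of_lt hij hlt h₂)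

theorem inversionCount_mul_swap (w : Equiv.Perm (Fin n)) {i j : Fin n} (hij : (i : ℕ) + 1 = j)
    (hw : w i < w j) : inversionCount (w * Equiv.swap i j) = inversionCount w + 1 := by
  have hlt : i < j := Fin.lt_def.2 (by omega)
  have h1 : inversionCount (w * Equiv.swap i j) =
      ∑ p, ∑ q, if Equiv.swap i j p < Equiv.swap i j q ∧ w q < w p then 1 else 0 := by
    rw [inversionCount, ← Equiv.sum_comp (Equiv.swap i j)]
    refine Finset.sum_congr rfl fun p _ => ?_
    rw [← Equiv.sum_comp (Equiv.swap i j)]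
    simp
  -- After reindexing by the transposition, the two counts agree termwise except at `(j, i)`, which
  -- gives the extra inversion.
  have h2 : ∀ p q : Fin n,
      (if Equiv.swap i j p < Equiv.swap i j q ∧ w q < w p then 1 else 0) =
        (if p < q ∧ w q < w p then 1 else 0) + if p = j then if q = i then 1 else 0 else 0 := by
    intro p q
    by_cases h₁ : p = i ∧ q = j
    · obtain ⟨rfl, rfl⟩ := h₁
      simp [hw.not_gt, hlt.ne]
    · by_cases h₂ : p = j ∧ q = i
      · obtain ⟨rfl, rfl⟩ := h₂
        simp [hw, hlt, hlt.not_gt]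
      · simp only [swap_lt_swap_iff hij h₁ h₂]
        have : (if p = j then if q = i then 1 else 0 else 0) = 0 := by
          split_ifs with h h' <;> first | rfl | exact absurd ⟨h, h'⟩ h₂
        rw [this, add_zero]
  rw [h1]
  simp only [h2, Finset.sum_add_distrib]
  simp [inversionCount]

theorem inversionCount_one : inversionCount (1 : Equiv.Perm (Fin n)) = 0 :=
  Finset.sum_eq_zero fun _ _ => Finset.sum_eq_zero fun _ _ =>
    if_neg fun h => h.1.asymm h.2

theorem inversionCount_le (w : Equiv.Perm (Fin n)) : inversionCount w ≤ n * n := by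
  have h : ∀ p : Fin n, (∑ q, if p < q ∧ w q < w p then 1 else 0) ≤ n := fun p =>
    (Finset.sum_le_card_nsmul _ _ 1 fun q _ => by split_ifs <;> simp).trans (by simp)
  exact (Finset.sum_le_card_nsmul _ _ n fun p _ => h p).trans (by simp)

/-- A strictly increasing map on `Fin n` is determined by its range. Used with `e = 1` to recognize
the identity and with `e = Fin.revPerm` for the longest element. -/
theorem perm_eq_of_strictMono_comp {w v e : Equiv.Perm (Fin n)} (hw : StrictMono (e ∘ w))
    (hv : StrictMono (e ∘ v)) : w = v := by
  have hrange : ∀ u : Equiv.Perm (Fin n), Set.range (e ∘ u) = Set.univ := fun u =>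
    Set.range_eq_univ.2 (e.surjective.comp u.surjective)
  have := hw.range_inj hv |>.1 ((hrange w).trans (hrange v).symm)
  ext i
  exact congrArg Fin.val (e.injective (congrFun this i))

theorem perm_eq_one_or_exists_descent {N : ℕ} (w : Equiv.Perm (Fin (N + 1))) :
    w = 1 ∨ ∃ i j : Fin (N + 1), (i : ℕ) + 1 = j ∧ w j < w i := by
  by_cases h : ∀ i : Fin N, w i.castSucc < w i.succ
  · exact Or.inl (perm_eq_of_strictMono_comp (e := 1) (Fin.strictMono_iff_lt_succ.2 h)
      strictMono_id)
  · push Not at h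
    obtain ⟨i, hi⟩ := h
    exact Or.inr ⟨i.castSucc, i.succ, by simp,
      lt_of_le_of_ne hi (w.injective.ne i.castSucc_lt_succ.ne')⟩

theorem perm_eq_revPerm_or_exists_ascent {N : ℕ} (w : Equiv.Perm (Fin (N + 1))) :
    w = Fin.revPerm ∨ ∃ i j : Fin (N + 1), (i : ℕ) + 1 = j ∧ w i < w j := by
  by_cases h : ∀ i : Fin N, w i.succ < w i.castSucc
  · refine Or.inl (perm_eq_of_strictMono_comp (e := Fin.revPerm)
      (Fin.strictMono_iff_lt_succ.2 fun i => by simpa using h i) ?_)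
    intro a b hab
    simpa using hab
  · push Not at h
    obtain ⟨i, hi⟩ := h
    exact Or.inr ⟨i.castSucc, i.succ, by simp,
      lt_of_le_of_ne hi (w.injective.ne i.castSucc_lt_succ.ne)⟩

theorem inversionCount_mul_le (w s : Equiv.Perm (Fin n)) (hs : IsSimpleRefl s) :
    inversionCount (w * s) ≤ inversionCount w + 1 := by
  obtain ⟨i, j, hij, rfl⟩ := hs
  have hne : i ≠ j := fun h => by rw [h] at hij; omega
  rcases lt_or_gt_of_ne (w.injective.ne hne) with h | h
  · exact (inversionCount_mul_swap w hij h).le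
  · have := inversionCount_mul_swap (w * Equiv.swap i j) hij (by simpa using h)
    rw [mul_assoc, Equiv.swap_mul_self, mul_one] at this
    omega

/-- A simple reflection raises the inversion count by at most one, which bounds every word from
below; removing descents one by one produces a word attaining the bound. -/
theorem weylLength_eq_inversionCount {N : ℕ} (w : Equiv.Perm (Fin (N + 1))) :
    weylLength w = inversionCount w := by
  have hle : ∀ l : List (Equiv.Perm (Fin (N + 1))), (∀ s ∈ l, IsSimpleRefl s) →
      inversionCount l.prod ≤ l.length := by
    intro l
    induction l using List.reverseRecOn with
    | nil => simp [inversionCount_one]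
    | append_singleton l s ih =>
      intro hl
      have h1 := ih fun t ht => hl t (by simp [ht])
      have h2 := inversionCount_mul_le l.prod s (hl s (by simp))
      simp only [List.prod_append, List.prod_singleton, List.length_append, List.length_singleton]
      omega
  have hex : ∀ (m : ℕ) (w : Equiv.Perm (Fin (N + 1))), inversionCount w = m →
      ∃ l : List (Equiv.Perm (Fin (N + 1))),
        l.length = m ∧ (∀ s ∈ l, IsSimpleRefl s) ∧ l.prod = w := by
    intro m
    induction m with
    | zero =>
      intro w hw
      rcases perm_eq_one_or_exists_descent w with rfl | ⟨i, j, hij, h⟩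
      · exact ⟨[], by simp⟩
      · have := inversionCount_mul_swap (w * Equiv.swap i j) hij (by simpa using h)
        rw [mul_assoc, Equiv.swap_mul_self, mul_one] at this
        omega
    | succ m ih =>
      intro w hw
      rcases perm_eq_one_or_exists_descent w with rfl | ⟨i, j, hij, h⟩
      · simp [inversionCount_one] at hw
      · have := inversionCount_mul_swap (w * Equiv.swap i j) hij (by simpa using h)
        rw [mul_assoc, Equiv.swap_mul_self, mul_one] at this
        obtain ⟨l, hl, hs, hp⟩ := ih (w * Equiv.swap i j) (by omega)
        refine ⟨l ++ [Equiv.swap i j], by simp [hl], ?_, by simp [hp, mul_assoc]⟩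
        intro s hs'
        rcases List.mem_append.1 hs' with h' | h'
        · exact hs s h'
        · exact ⟨i, j, hij, by simpa using h'⟩
  have hmem := hex _ w rfl
  refine le_antisymm (Nat.sInf_le hmem) ?_
  obtain ⟨l, hl, hs, hp⟩ := Nat.sInf_mem (s := {m | ∃ l : List (Equiv.Perm (Fin (N + 1))),
    l.length = m ∧ (∀ s ∈ l, IsSimpleRefl s) ∧ l.prod = w}) ⟨_, hmem⟩
  have := hle l hs
  rwa [hp, hl] at this

/-- The rotation carries the last value `m` of `w` to the front. Its `N - m` inversions with the
larger values are replaced by `m` inversions with the smaller ones; all other pairs keep their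
order. -/
theorem inversionCount_mul_finRotate_inv {N : ℕ} (w : Equiv.Perm (Fin (N + 1))) :
    (inversionCount (w * (finRotate (N + 1))⁻¹) : ℤ) =
      inversionCount w + 2 * (w (Fin.last N) : ℕ) - N := by
  have h1 : inversionCount (w * (finRotate (N + 1))⁻¹) =
      (∑ q : Fin N, if w q.castSucc < w (Fin.last N) then 1 else 0) +
        ∑ p : Fin N, ∑ q : Fin N, if p < q ∧ w q.castSucc < w p.castSucc then 1 else 0 := by
    rw [inversionCount, Fin.sum_univ_succ]
    simp only [Fin.sum_univ_succ, Equiv.Perm.mul_apply, finRotate_inv_zero, finRotate_inv_succ]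
    simp
  have h2 : inversionCount w =
      (∑ q : Fin N, if w (Fin.last N) < w q.castSucc then 1 else 0) +
        ∑ p : Fin N, ∑ q : Fin N, if p < q ∧ w q.castSucc < w p.castSucc then 1 else 0 := by
    rw [inversionCount, Fin.sum_univ_castSucc]
    simp only [Fin.sum_univ_castSucc, Finset.sum_add_distrib, Fin.castSucc_lt_castSucc_iff,
      Fin.castSucc_lt_last, true_and, false_and, if_false, add_zero,
      (Fin.le_last _).not_gt, Finset.sum_const_zero]
    exact add_comm _ _
  have h3 : (∑ q : Fin N, if w q.castSucc < w (Fin.last N) then 1 else 0) =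
      (w (Fin.last N) : ℕ) := by
    have : (∑ q, if w q < w (Fin.last N) then 1 else 0) = (w (Fin.last N) : ℕ) := by
      rw [Equiv.sum_comp w fun x => if x < w (Fin.last N) then 1 else 0, ← Finset.card_filter,
        Finset.filter_gt_eq_Iio, Fin.card_Iio]
    rwa [Fin.sum_univ_castSucc, if_neg (lt_irrefl _), add_zero] at this
  have h4 : (∑ q : Fin N, if w (Fin.last N) < w q.castSucc then 1 else 0) +
      (∑ q : Fin N, if w q.castSucc < w (Fin.last N) then 1 else 0) = N := by
    rw [← Finset.sum_add_distrib, Finset.sum_congr rfl (g := fun _ => 1)]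
    · simp
    · intro q _
      rcases lt_or_gt_of_ne (w.injective.ne q.castSucc_lt_last.ne) with h | h <;>
        simp [h, h.not_gt]
  rw [h3] at h1 h4
  omega

end Length

/-! ### Connectedness of the set of dominant pairs. -/

section Dominant

variable {n : ℕ}

theorem IsDominant.neg_one_le {w : Equiv.Perm (Fin n)} {k : Fin n → ℤ} (h : IsDominant w k)
    {i j : Fin n} (hij : (i : ℕ) + 1 = j) : -1 ≤ k i - k j := by
  have hne : i ≠ j := fun h => by rw [h] at hij; omega
  rcases lt_or_gt_of_ne (w⁻¹.injective.ne hne) with h' | h'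
  · linarith [(h i j hij).1 h']
  · exact (h i j hij).2 h'

theorem isDominant_one_zero : IsDominant (1 : Equiv.Perm (Fin n)) 0 := by
  intro i j _
  simp

theorem isDominant_iff {w : Equiv.Perm (Fin n)} {k : Fin n → ℤ}
    (h : ∀ i j : Fin n, (i : ℕ) + 1 = j → -1 ≤ k i - k j) :
    IsDominant w k ↔ ∀ p q, p < q → (w p : ℕ) + 1 = w q → 0 ≤ k (w p) - k (w q) := by
  constructor
  · intro hd p q hpq hw
    exact (hd _ _ hw).1 (by simpa using hpq)
  · intro hd i j hij
    refine ⟨fun hlt => ?_, fun _ => h i j hij⟩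
    simpa using hd _ _ hlt (by simpa using hij)

/-- Longer elements impose fewer strong inequalities: an ascent turned into a descent creates no new
pair of adjacent values in increasing order. -/
theorem IsDominant.mul_swap {w : Equiv.Perm (Fin n)} {k : Fin n → ℤ} (h : IsDominant w k)
    {i j : Fin n} (hij : (i : ℕ) + 1 = j) (hw : w i < w j) :
    IsDominant (w * Equiv.swap i j) k := by
  have hP : ∀ i j : Fin n, (i : ℕ) + 1 = j → -1 ≤ k i - k j := fun i j hij => h.neg_one_le hij
  rw [isDominant_iff hP] at h ⊢
  intro p q hpq hadj
  rw [Equiv.Perm.mul_apply, Equiv.Perm.mul_apply] at *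
  by_cases h' : p = i ∧ q = j
  · obtain ⟨rfl, rfl⟩ := h'
    rw [Equiv.swap_apply_left, Equiv.swap_apply_right] at hadj
    have := Fin.lt_def.1 hw
    omega
  · exact h _ _ (swap_lt_swap_of_lt hij hpq fun h => h' ⟨h.2, h.1⟩) hadj

/-- The permutation sending the last index to `m` and decreasing on the other indices. -/
def lastDecreasing {N : ℕ} (m : Fin (N + 1)) : Equiv.Perm (Fin (N + 1)) :=
  (finSuccEquiv' (Fin.last N)).trans ((Equiv.optionCongr Fin.revPerm).trans
    (finSuccEquiv' m).symm)

theorem lastDecreasing_last {N : ℕ} (m : Fin (N + 1)) : lastDecreasing m (Fin.last N) = m := by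
  simp [lastDecreasing]

theorem lastDecreasing_castSucc {N : ℕ} (m : Fin (N + 1)) (i : Fin N) :
    lastDecreasing m i.castSucc = m.succAbove i.rev := by
  rw [← Fin.succAbove_last_apply]
  simp [lastDecreasing, -Fin.succAbove_last]

variable {N : ℕ} {α : Type*} {f : (Fin (N + 1) → ℤ) → Equiv.Perm (Fin (N + 1)) → α}
  (hs : ∀ k w (i j : Fin (N + 1)), (i : ℕ) + 1 = j → w i < w j → IsDominant w k →
    f k (w * Equiv.swap i j) = f k w)
  (hu : ∀ k w, f (k + Pi.single (w (Fin.last N)) 1) (w * (finRotate (N + 1))⁻¹) = f k w)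

include hs in
theorem eq_revPerm_of_isDominant {k : Fin (N + 1) → ℤ} {w : Equiv.Perm (Fin (N + 1))}
    (h : IsDominant w k) : f k w = f k Fin.revPerm := by
  induction hm : (N + 1) * (N + 1) - inversionCount w using Nat.strong_induction_on
    generalizing w with
  | _ m ih =>
    rcases perm_eq_revPerm_or_exists_ascent w with rfl | ⟨i, j, hij, hw⟩
    · rfl
    · have h1 := inversionCount_mul_swap w hij hw
      have h2 := inversionCount_le (w * Equiv.swap i j)
      rw [← hs k w i j hij hw h]
      exact ih _ (by omega) (h.mul_swap hij hw) rfl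

include hs hu in
-- Take `w` with last value `m` and decreasing elsewhere. Consecutive values in increasing order
-- must then involve `m`, so dominance of `(k, w)` reduces to the bound `hk'` just before `m`, and
-- dominance of its translate by `u` to the bound `hk` just after `m`. Both ends then climb to the
-- longest element.
theorem revPerm_add_single {k : Fin (N + 1) → ℤ} {m : Fin (N + 1)}
    (hk : ∀ i j : Fin (N + 1), (i : ℕ) + 1 = j → -1 ≤ k i - k j)
    (hk' : ∀ i j : Fin (N + 1), (i : ℕ) + 1 = j →
      -1 ≤ (k + Pi.single m 1 : Fin (N + 1) → ℤ) i - (k + Pi.single m 1 : Fin (N + 1) → ℤ) j) :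
    f (k + Pi.single m 1) Fin.revPerm = f k Fin.revPerm := by
  have hanti : ∀ p q : Fin N, p < q →
      ((m.succAbove p.rev : Fin (N + 1)) : ℕ) + 1 ≠ m.succAbove q.rev := by
    intro p q hpq h
    have := Fin.lt_def.1 (Fin.strictMono_succAbove m (Fin.rev_lt_rev.2 hpq))
    omega
  have h1 : IsDominant (lastDecreasing m) k := by
    rw [isDominant_iff hk]
    intro p q hpq hadj
    rcases Fin.eq_castSucc_or_eq_last p with ⟨p, rfl⟩ | rfl
    · rcases Fin.eq_castSucc_or_eq_last q with ⟨q, rfl⟩ | rfl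
      · rw [lastDecreasing_castSucc, lastDecreasing_castSucc] at hadj
        exact absurd hadj (hanti _ _ (by simpa using hpq))
      · have := hk' _ _ hadj
        have hne : lastDecreasing m p.castSucc ≠ m := fun h => by
          rw [h, lastDecreasing_last] at hadj
          omega
        simp only [lastDecreasing_last, Pi.add_apply, Pi.single_eq_same,
          Pi.single_eq_of_ne hne] at this ⊢
        linarith
    · exact absurd hpq (Fin.le_last _).not_gt
  have h2 : IsDominant (lastDecreasing m * (finRotate (N + 1))⁻¹) (k + Pi.single m 1) := by
    rw [isDominant_iff hk']
    intro p q hpq hadj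
    cases q using Fin.cases with
    | zero => exact absurd hpq (Fin.not_lt_zero _)
    | succ q =>
      cases p using Fin.cases with
      | zero =>
        rw [Equiv.Perm.mul_apply, Equiv.Perm.mul_apply, finRotate_inv_zero,
          lastDecreasing_last] at *
        have := hk _ _ hadj
        have hne : lastDecreasing m ((finRotate (N + 1))⁻¹ q.succ) ≠ m := fun h => by
          rw [h] at hadj
          omega
        simp only [Pi.add_apply, Pi.single_eq_same, Pi.single_eq_of_ne hne]
        linarith
      | succ p =>
        rw [Equiv.Perm.mul_apply, Equiv.Perm.mul_apply, finRotate_inv_succ, finRotate_inv_succ,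
          lastDecreasing_castSucc, lastDecreasing_castSucc] at hadj
        exact absurd hadj (hanti _ _ (by simpa using hpq))
  have h3 := hu k (lastDecreasing m)
  rw [lastDecreasing_last] at h3
  rw [← eq_revPerm_of_isDominant hs h1, ← eq_revPerm_of_isDominant hs h2, h3]

include hs hu in
theorem revPerm_eq_of_le (M : ℤ) {k : Fin (N + 1) → ℤ}
    (hk : ∀ i j : Fin (N + 1), (i : ℕ) + 1 = j → -1 ≤ k i - k j)
    (hM : ∀ i : Fin (N + 1), M + (i : ℕ) ≤ k i) : f k Fin.revPerm = f (fun i => M + (i : ℕ)) Fin.revPerm := by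
  induction hm : (∑ i, (k i - (M + (i : ℕ)))).toNat using Nat.strong_induction_on
    generalizing k with
  | _ d ih =>
    by_cases hall : ∀ i, k i = M + (i : ℕ)
    · rw [funext hall]
    · push Not at hall
      -- Lowering the last coordinate above the floor `M + i` is safe: the next coordinate sits on
      -- the floor, so their difference stays at least `-1`.
      obtain ⟨m, hm1, hm2⟩ := (Finset.univ.filter fun i : Fin (N + 1) =>
        k i ≠ M + (i : ℕ)).exists_maximal (by simpa [Finset.filter_nonempty_iff] using hall)
      have hmk : M + (m : ℕ) < k m := lt_of_le_of_ne (hM m) (Ne.symm (by simpa using hm1))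
      have hmax : ∀ i, m < i → k i = M + (i : ℕ) := by
        intro i hi
        by_contra h
        exact hi.not_ge (hm2 (by simpa using h) hi.le)
      set k' : Fin (N + 1) → ℤ := k - Pi.single m 1 with hk'def
      have hkk' : k = k' + Pi.single m 1 := by simp [hk'def]
      have hk'm : k' m = k m - 1 := by simp [hk'def]
      have hk'ne : ∀ i, i ≠ m → k' i = k i := fun i hi => by simp [hk'def, hi]
      have hP : ∀ i j : Fin (N + 1), (i : ℕ) + 1 = j → -1 ≤ k' i - k' j := by
        intro i j hij
        have h0 := hk i j hij
        by_cases hi : i = m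
        · subst hi
          have hlt : i < j := Fin.lt_def.2 (by omega)
          rw [hk'm, hk'ne j hlt.ne', hmax j hlt]
          omega
        · rw [hk'ne i hi]
          by_cases hj : j = m
          · subst hj
            rw [hk'm]
            omega
          · rwa [hk'ne j hj]
      have hM' : ∀ i : Fin (N + 1), M + (i : ℕ) ≤ k' i := by
        intro i
        by_cases hi : i = m
        · subst hi
          rw [hk'm]
          omega
        · rw [hk'ne i hi]
          exact hM i
      have hsum : ∑ i, (k i - (M + (i : ℕ))) = ∑ i, (k' i - (M + (i : ℕ))) + 1 := by
        rw [hkk']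
        simp only [Pi.add_apply, Finset.sum_sub_distrib, Finset.sum_add_distrib]
        rw [Finset.sum_pi_single', if_pos (Finset.mem_univ _)]
        ring
      have hpos : 0 ≤ ∑ i, (k' i - (M + (i : ℕ))) :=
        Finset.sum_nonneg fun i _ => by linarith [hM' i]
      rw [← ih _ (by omega) hP hM' rfl]
      conv_lhs => rw [hkk']
      exact revPerm_add_single hs hu hP (by rwa [← hkk'])

include hs hu in
/-- The dominant pairs `(k, w)` are connected by right multiplication with simple reflections and
with the element `uElt`. -/
theorem eq_of_isDominant {k : Fin (N + 1) → ℤ} {w : Equiv.Perm (Fin (N + 1))}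
    (h : IsDominant w k) : f k w = f 0 1 := by
  -- One floor lying below both `k` and `0`, so that both descend to the same weight; `-N` absorbs
  -- the slope `i ≤ N`.
  have hbound : ∀ i : Fin (N + 1), -(∑ i, |k i|) - N + (i : ℕ) ≤ k i := by
    intro i
    have h1 := Finset.single_le_sum (f := fun i => |k i|) (fun i _ => abs_nonneg _)
      (Finset.mem_univ i)
    have h2 := neg_abs_le (k i)
    have h3 := i.isLt
    omega
  have h0 : ∀ i : Fin (N + 1), -(∑ i, |k i|) - N + (i : ℕ) ≤ (0 : Fin (N + 1) → ℤ) i := by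
    intro i
    have h1 : 0 ≤ ∑ i, |k i| := Finset.sum_nonneg fun i _ => abs_nonneg _
    have h3 := i.isLt
    rw [Pi.zero_apply]
    omega
  rw [eq_revPerm_of_isDominant hs h, eq_revPerm_of_isDominant hs isDominant_one_zero,
    revPerm_eq_of_le hs hu _ (fun i j => h.neg_one_le) hbound,
    revPerm_eq_of_le hs hu _ (fun i j => isDominant_one_zero.neg_one_le) h0]

end Dominant

/-! ### Vanishing, recursions and the values of `W`. -/

section Values

variable {N : ℕ} {F : Type*} [Field F] [ValuativeRel F] [TopologicalSpace F]
  [IsNonarchimedeanLocalField F] {ϖ : Fˣ}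
  [MeasurableSpace (GL (Fin (N + 1)) F)] {μ : Measure (GL (Fin (N + 1)) F)}
  {ψ : AddChar F ℂ} {ε : ℂ} {W : GL (Fin (N + 1)) F → ℂ}

theorem IsSteinbergWhittaker.eq_zero_of_not_isDominant (hW : IsSteinbergWhittaker μ ϖ ψ ε W)
    (hϖ : IsUnif ϖ) (hψ : IsUnramifiedChar ϖ ψ) {k : Fin (N + 1) → ℤ}
    {w : Equiv.Perm (Fin (N + 1))} (hk : ¬ IsDominant w k) :
    W (unifPow ϖ k * weylElt F w) = 0 := by
  obtain ⟨x, hx, hψx⟩ := hψ.2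
  have hx : valuation F x ≤ 1 := hx
  unfold IsDominant at hk
  push Not at hk
  obtain ⟨i, j, hij, hk⟩ := hk
  obtain ⟨p, rfl⟩ := w.surjective i
  obtain ⟨q, rfl⟩ := w.surjective j
  have hlt : w p < w q := Fin.lt_def.2 (by omega)
  have hpq : p ≠ q := fun h => hlt.ne (congrArg w h)
  -- Chosen so that passing across `ϖ^k w` turns `b` into `ϖ⁻¹ x`, where `ψ` is nontrivial. Failure
  -- of dominance makes the exponent at least `0` if `p < q` and at least `1` if `q < p`, just what
  -- membership in `J` needs.
  set b : F := ((ϖ ^ (k (w q) - k (w p) - 1) : Fˣ) : F) * x with hb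
  have hmem : rootElt hpq b ∈ iwahori (N + 1) F := by
    simp only [Equiv.Perm.inv_def, Equiv.symm_apply_apply] at hk
    rcases lt_or_gt_of_ne hpq with h | h
    · refine rootElt_mem_iwahori_of_lt h ?_
      have hneg : k (w p) - k (w q) < 0 := by
        by_contra h'
        exact (hk fun _ => not_lt.1 h').1.asymm h
      rw [hb, map_mul]
      exact mul_le_one' (hϖ.valuation_zpow_le_one (by omega)) hx
    · refine rootElt_mem_iwahori_of_gt h ?_
      have hneg : k (w p) - k (w q) < -1 := (hk fun h' => absurd h' h.asymm).2
      rw [hb, map_mul]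
      exact mul_lt_one_of_lt_of_le (hϖ.valuation_zpow_lt_one (by omega)) hx
  have h1 := hW.iwahori_inv (unifPow ϖ k * weylElt F w) _ hmem
  have hval : ((ϖ ^ (k (w p) - k (w q)) : Fˣ) : F) * b = (ϖ : F)⁻¹ * x := by
    rw [hb, ← mul_assoc, ← Units.val_mul, ← zpow_add,
      show k (w p) - k (w q) + (k (w q) - k (w p) - 1) = -1 by ring, zpow_neg_one,
      Units.val_inv_eq_inv_val]
  rw [unifPow_mul_weylElt_mul_rootElt, hval, hW.whittaker _ _ (isUnipotentUpper_rootElt hlt _),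
    unipChar_rootElt ψ hlt, if_pos hij] at h1
  have h2 : (ψ ((ϖ : F)⁻¹ * x) - 1) * W (unifPow ϖ k * weylElt F w) = 0 := by
    rw [sub_mul, h1, one_mul, sub_self]
  exact (mul_eq_zero.1 h2).resolve_left (sub_ne_zero.2 hψx)

section Hecke

variable [BorelSpace (GL (Fin (N + 1)) F)] [μ.IsHaarMeasure]
  (hμ : μ (iwahori (N + 1) F : Set (GL (Fin (N + 1)) F)) = 1)

include hμ

/-- Each representative's root element passes to the left into `N`. There `ψ` is trivial: either the
root is not simple, or dominance makes the argument integral. So all `q` summands coincide. -/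
theorem IsSteinbergWhittaker.resCard_mul_apply_mul_swap (hW : IsSteinbergWhittaker μ ϖ ψ ε W)
    (hϖ : IsUnif ϖ) (hψ : IsUnramifiedChar ϖ ψ) {k : Fin (N + 1) → ℤ}
    {w : Equiv.Perm (Fin (N + 1))} (hk : IsDominant w k) {i j : Fin (N + 1)}
    (hij : (i : ℕ) + 1 = j) (hw : w i < w j) :
    (resCard F : ℂ) * W (unifPow ϖ k * weylElt F (w * Equiv.swap i j)) =
      -W (unifPow ϖ k * weylElt F w) := by
  let _ : Fintype 𝓀[F] := Fintype.ofFinite _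
  rw [← hW.hecke_simple _ ⟨i, j, hij, rfl⟩, heckeOp_swap hμ hW.iwahori_inv hij,
    Finset.sum_congr rfl (g := fun _ => W (unifPow ϖ k * weylElt F (w * Equiv.swap i j)))]
  · simp [resCard, Nat.card_eq_fintype_card]
  · intro a _
    rw [← mul_assoc, unifPow_mul_weylElt_mul_rootElt, mul_assoc, mul_assoc, weylElt_mul,
      hW.whittaker _ _ (isUnipotentUpper_rootElt hw _), unipChar_rootElt ψ hw]
    convert one_mul _
    split_ifs with h
    · refine hψ.1 _ ?_
      have h0 := (hk _ _ h).1 (by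
        simpa using Fin.lt_def.2 (show (i : ℕ) < j by omega))
      change valuation F _ ≤ 1
      rw [map_mul]
      exact mul_le_one' (hϖ.valuation_zpow_le_one h0) (residueLift a).2
    · exact AddChar.map_zero_eq_one ψ

theorem IsSteinbergWhittaker.apply_mul_uElt (hW : IsSteinbergWhittaker μ ϖ ψ ε W)
    (hϖ : IsUnif ϖ) (x : GL (Fin (N + 1)) F) : W (x * uElt ϖ) = ε * W x := by
  rw [← hW.hecke_u, heckeOp_uElt hμ hW.iwahori_inv hϖ]

theorem IsSteinbergWhittaker.apply_add_single (hW : IsSteinbergWhittaker μ ϖ ψ ε W)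
    (hϖ : IsUnif ϖ) (k : Fin (N + 1) → ℤ) (w : Equiv.Perm (Fin (N + 1))) :
    W (unifPow ϖ (k + Pi.single (w (Fin.last N)) 1) * weylElt F (w * (finRotate (N + 1))⁻¹)) =
      ε * W (unifPow ϖ k * weylElt F w) := by
  rw [← hW.apply_mul_uElt hμ hϖ, uElt_eq, mul_assoc, ← mul_assoc (weylElt F w),
    weylElt_mul_unifPow, mul_assoc, weylElt_mul, ← mul_assoc, unifPow_mul_unifPow]
  congr 4
  ext i
  simp [Pi.single_apply, Equiv.symm_apply_eq]

theorem IsSteinbergWhittaker.eps_ne_zero (hW : IsSteinbergWhittaker μ ϖ ψ ε W)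
    (hϖ : IsUnif ϖ) : ε ≠ 0 := by
  rintro rfl
  have := hW.apply_mul_uElt hμ hϖ (uElt ϖ)⁻¹
  rw [inv_mul_cancel, hW.map_one, zero_mul] at this
  exact one_ne_zero this

end Hecke

section Formula

omit [MeasurableSpace (GL (Fin (N + 1)) F)]

theorem deltaB_zero : deltaB (fun i => ϖ ^ (0 : Fin (N + 1) → ℤ) i) = 1 := by
  refine Finset.prod_eq_one fun i _ => ?_
  simp [stdAbs]

theorem deltaB_add_single (hϖ : IsUnif ϖ) (k : Fin (N + 1) → ℤ) (m : Fin (N + 1)) :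
    deltaB (fun i => ϖ ^ (k + Pi.single m 1 : Fin (N + 1) → ℤ) i) =
      deltaB (fun i => ϖ ^ k i) * (resCard F : ℝ) ^ (2 * (m : ℤ) - N) := by
  have hq : (resCard F : ℝ) ≠ 0 := Nat.cast_ne_zero.2 resCard_ne_zero
  have hm : (resCard F : ℝ) ^ (2 * (m : ℤ) - N) = ∏ i : Fin (N + 1),
      (resCard F : ℝ) ^ (-(Pi.single m 1 : Fin (N + 1) → ℤ) i *
        (((N + 1 : ℕ) : ℤ) - 1 - 2 * (i : ℤ))) := by
    rw [Finset.prod_eq_single m]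
    · rw [Pi.single_eq_same]
      congr 1
      push_cast
      ring
    · intro b _ hb
      simp [hb]
    · simp
  rw [hm, deltaB, deltaB, ← Finset.prod_mul_distrib]
  refine Finset.prod_congr rfl fun i _ => ?_
  rw [hϖ.stdAbs_zpow, hϖ.stdAbs_zpow, ← zpow_mul, ← zpow_mul, ← zpow_add₀ hq, Pi.add_apply]
  congr 1
  ring

theorem deltaB_ne_zero (hϖ : IsUnif ϖ) (k : Fin (N + 1) → ℤ) :
    deltaB (fun i => ϖ ^ k i) ≠ 0 := by
  refine Finset.prod_ne_zero_iff.2 fun i _ => zpow_ne_zero _ ?_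
  rw [hϖ.stdAbs_zpow]
  exact zpow_ne_zero _ (Nat.cast_ne_zero.2 resCard_ne_zero)

/-- The value of a normalized Steinberg Whittaker function at a dominant element. -/
noncomputable def dominantValue (ϖ : Fˣ) (ε : ℂ) (k : Fin (N + 1) → ℤ)
    (w : Equiv.Perm (Fin (N + 1))) : ℂ :=
  ε ^ (∑ i, k i) * (-1 : ℂ) ^ ((((N + 1 : ℕ) : ℤ) - 1) * ∑ i, k i) *
    (deltaB (fun i => ϖ ^ k i) : ℂ) * (-(resCard F : ℂ)) ^ (-(weylLength w : ℤ))

theorem neg_resCard_ne_zero : -(resCard F : ℂ) ≠ 0 :=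
  neg_ne_zero.2 (Nat.cast_ne_zero.2 resCard_ne_zero)

theorem dominantValue_ne_zero (hϖ : IsUnif ϖ) (hε : ε ≠ 0) (k : Fin (N + 1) → ℤ)
    (w : Equiv.Perm (Fin (N + 1))) : dominantValue ϖ ε k w ≠ 0 :=
  mul_ne_zero (mul_ne_zero (mul_ne_zero (zpow_ne_zero _ hε) (zpow_ne_zero _ (by norm_num)))
    (Complex.ofReal_ne_zero.2 (deltaB_ne_zero hϖ k))) (zpow_ne_zero _ neg_resCard_ne_zero)

theorem dominantValue_zero_one : dominantValue ϖ ε (0 : Fin (N + 1) → ℤ) 1 = 1 := by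
  have := deltaB_zero (ϖ := ϖ) (N := N)
  simp only [Pi.zero_apply, zpow_zero] at this
  simp [dominantValue, this, weylLength_eq_inversionCount, inversionCount_one]

theorem dominantValue_mul_swap (k : Fin (N + 1) → ℤ) {w : Equiv.Perm (Fin (N + 1))}
    {i j : Fin (N + 1)} (hij : (i : ℕ) + 1 = j) (hw : w i < w j) :
    (resCard F : ℂ) * dominantValue ϖ ε k (w * Equiv.swap i j) = -dominantValue ϖ ε k w := by
  have hq : (resCard F : ℂ) ≠ 0 := Nat.cast_ne_zero.2 resCard_ne_zero
  rw [dominantValue, dominantValue, weylLength_eq_inversionCount, weylLength_eq_inversionCount,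
    inversionCount_mul_swap w hij hw]
  push_cast
  rw [neg_add, zpow_add₀ neg_resCard_ne_zero, zpow_neg_one]
  field_simp

theorem dominantValue_add_single (hϖ : IsUnif ϖ) (hε : ε ≠ 0) (k : Fin (N + 1) → ℤ)
    (w : Equiv.Perm (Fin (N + 1))) :
    dominantValue ϖ ε (k + Pi.single (w (Fin.last N)) 1) (w * (finRotate (N + 1))⁻¹) =
      ε * dominantValue ϖ ε k w := by
  have hq : (resCard F : ℂ) ≠ 0 := Nat.cast_ne_zero.2 resCard_ne_zero
  set m := w (Fin.last N) with hm
  have hsum : ∑ i, (k + Pi.single m 1 : Fin (N + 1) → ℤ) i = ∑ i, k i + 1 := by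
    simp [Finset.sum_add_distrib]
  have hlen : -((inversionCount (w * (finRotate (N + 1))⁻¹) : ℕ) : ℤ) =
      -(inversionCount w : ℤ) + -(2 * (m : ℤ) - N) := by
    rw [inversionCount_mul_finRotate_inv]
    ring
  -- The powers of `q` from `deltaB` and from the length cancel; the remaining sign has the even
  -- exponent `2 * (N - m)`. This is why the formula carries `(-1)^(n-1)`.
  have hsign : (-1 : ℂ) ^ (((N + 1 : ℕ) : ℤ) - 1) * ((resCard F : ℂ) ^ (2 * (m : ℤ) - N) *
      (-(resCard F : ℂ)) ^ (-(2 * (m : ℤ) - N))) = 1 := by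
    rw [neg_eq_neg_one_mul (resCard F : ℂ), mul_zpow, mul_left_comm ((resCard F : ℂ) ^ _),
      ← zpow_add₀ hq, add_neg_cancel, zpow_zero, mul_one, ← zpow_add₀ (by norm_num)]
    exact Even.neg_one_zpow ⟨N - m, by push_cast; ring⟩
  rw [dominantValue, dominantValue, weylLength_eq_inversionCount, weylLength_eq_inversionCount,
    hsum, hlen, deltaB_add_single hϖ, mul_add, mul_one, zpow_add₀ hε, zpow_one,
    zpow_add₀ (by norm_num), zpow_add₀ neg_resCard_ne_zero]
  push_cast at hsign ⊢
  linear_combination (ε ^ (∑ i, k i) * ε * (-1 : ℂ) ^ (((N : ℤ) + 1 - 1) * ∑ i, k i) *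
    (deltaB (fun i => ϖ ^ k i) : ℂ) * (-(resCard F : ℂ)) ^ (-(inversionCount w : ℤ))) * hsign

end Formula

theorem IsSteinbergWhittaker.eq_dominantValue [BorelSpace (GL (Fin (N + 1)) F)]
    [μ.IsHaarMeasure] (hμ : μ (iwahori (N + 1) F : Set (GL (Fin (N + 1)) F)) = 1)
    (hW : IsSteinbergWhittaker μ ϖ ψ ε W) (hϖ : IsUnif ϖ) (hψ : IsUnramifiedChar ϖ ψ)
    {k : Fin (N + 1) → ℤ} {w : Equiv.Perm (Fin (N + 1))} (hk : IsDominant w k) :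
    W (unifPow ϖ k * weylElt F w) = dominantValue ϖ ε k w := by
  have hε := hW.eps_ne_zero hμ hϖ
  have hV := dominantValue_ne_zero (N := N) hϖ hε
  have hq : (resCard F : ℂ) ≠ 0 := Nat.cast_ne_zero.2 resCard_ne_zero
  have key := eq_of_isDominant
    (f := fun k w => W (unifPow ϖ k * weylElt F w) / dominantValue ϖ ε k w)
    (fun k w i j hij hw hk => by
      have h1 := hW.resCard_mul_apply_mul_swap hμ hϖ hψ hk hij hw
      have h2 := dominantValue_mul_swap (ϖ := ϖ) (ε := ε) k hij hw
      rw [← mul_div_mul_left _ _ hq, h1, h2, neg_div_neg_eq])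
    (fun k w => by
      rw [hW.apply_add_single hμ hϖ, dominantValue_add_single hϖ hε, mul_div_mul_left _ _ hε])
    hk
  rw [unifPow_zero, weylElt_one, mul_one, hW.map_one, dominantValue_zero_one, div_one] at key
  exact (div_eq_one_iff_eq (hV k w)).1 key

end Values

/-! ### Unipotent matrices and the elimination matrices. -/

section Unipotent

variable {n : ℕ} {F : Type*} [Field F]

theorem mul_apply_self_of_mem_borelSubgroup {a b : GL (Fin n) F} (ha : a ∈ borelSubgroup n F)
    (hb : b ∈ borelSubgroup n F) (i : Fin n) : (a * b) i i = a i i * b i i := by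
  rw [Units.val_mul, Matrix.mul_apply, Finset.sum_eq_single i]
  · intro l _ hl
    rcases lt_or_gt_of_ne hl with h | h
    · rw [ha i l h, zero_mul]
    · rw [hb l i h, mul_zero]
  · simp

theorem IsUnipotentUpper.mul {a b : GL (Fin n) F} (ha : IsUnipotentUpper a)
    (hb : IsUnipotentUpper b) : IsUnipotentUpper (a * b) :=
  ⟨(borelSubgroup n F).mul_mem ha.1 hb.1, fun i => by
    rw [mul_apply_self_of_mem_borelSubgroup ha.1 hb.1, ha.2, hb.2, one_mul]⟩

theorem IsUnipotentUpper.inv {a : GL (Fin n) F} (ha : IsUnipotentUpper a) :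
    IsUnipotentUpper a⁻¹ := by
  have h : a⁻¹ ∈ borelSubgroup n F := inv_mem (show a ∈ borelSubgroup n F from ha.1)
  refine ⟨h, fun i => ?_⟩
  have := mul_apply_self_of_mem_borelSubgroup h ha.1 i
  rw [inv_mul_cancel, ha.2, mul_one] at this
  simpa using this.symm

theorem isUnipotentUpper_one : IsUnipotentUpper (1 : GL (Fin n) F) :=
  ⟨fun _ _ hij => Matrix.one_apply_ne hij.ne', fun i => Matrix.one_apply_eq i⟩

/-- The identity matrix with row `a` replaced by `y`. -/
def rowElt (a : Fin n) (y : Fin n → F) (hy : y a ≠ 0) : GL (Fin n) F :=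
  Matrix.GeneralLinearGroup.mkOfDetNeZero ((1 : Matrix (Fin n) (Fin n) F).updateRow a y) (by
    -- By Cramer's rule for the identity, the determinant is the coordinate `y a`.
    rw [← Matrix.cramer_transpose_apply]
    simpa using hy)

/-- The identity matrix with column `a` replaced by `z`. -/
def colElt (a : Fin n) (z : Fin n → F) (hz : z a ≠ 0) : GL (Fin n) F :=
  Matrix.GeneralLinearGroup.mkOfDetNeZero ((1 : Matrix (Fin n) (Fin n) F).updateCol a z) (by
    rw [← Matrix.cramer_apply]
    simpa using hz)

theorem rowElt_apply (a : Fin n) (y : Fin n → F) (hy : y a ≠ 0) (p q : Fin n) :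
    rowElt a y hy p q = if p = a then y q else if p = q then 1 else 0 := by
  change (1 : Matrix (Fin n) (Fin n) F).updateRow a y p q = _
  simp [Matrix.updateRow_apply, Matrix.one_apply]

theorem colElt_apply (a : Fin n) (z : Fin n → F) (hz : z a ≠ 0) (p q : Fin n) :
    colElt a z hz p q = if q = a then z p else if p = q then 1 else 0 := by
  change (1 : Matrix (Fin n) (Fin n) F).updateCol a z p q = _
  simp [Matrix.updateCol_apply, Matrix.one_apply]

theorem mul_rowElt_apply (g : GL (Fin n) F) (a : Fin n) (y : Fin n → F) (hy : y a ≠ 0)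
    (p q : Fin n) :
    (g * rowElt a y hy) p q = (if q = a then 0 else g p q) + g p a * y q := by
  rw [Units.val_mul, Matrix.mul_apply]
  have : ∀ l, g p l * rowElt a y hy l q =
      (if l = q then if q = a then 0 else g p q else 0) + if l = a then g p a * y q else 0 := by
    intro l
    rw [rowElt_apply]
    by_cases hl : l = a
    · subst hl
      by_cases hq : l = q <;> simp [hq]
    · by_cases hq : l = q
      · subst hq
        simp [hl]
      · simp [hl, hq]
  simp [this, Finset.sum_add_distrib]

theorem colElt_mul_apply (g : GL (Fin n) F) (a : Fin n) (z : Fin n → F) (hz : z a ≠ 0)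
    (p q : Fin n) :
    (colElt a z hz * g) p q = (if p = a then 0 else g p q) + z p * g a q := by
  rw [Units.val_mul, Matrix.mul_apply]
  have : ∀ l, colElt a z hz p l * g l q =
      (if l = p then if p = a then 0 else g p q else 0) + if l = a then z p * g a q else 0 := by
    intro l
    rw [colElt_apply]
    by_cases hl : l = a
    · subst hl
      by_cases hp : l = p <;> simp [hp]
    · by_cases hp : l = p
      · subst hp
        simp [hl]
      · simp [hl, hp, Ne.symm hp]
  simp [this, Finset.sum_add_distrib]

end Unipotent

/-! ### Elimination for the decomposition into double cosets of `N` and `J`. -/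

section Decomposition

variable {n : ℕ} {F : Type*} [Field F] [ValuativeRel F] [TopologicalSpace F]
  [IsNonarchimedeanLocalField F] {ϖ : Fˣ}

/-- The row `i` of `g` has a single nonzero entry, a power of `ϖ`, which is also the only nonzero
entry in its column. -/
def IsMonomialRow (ϖ : Fˣ) (g : GL (Fin n) F) (i : Fin n) : Prop :=
  ∃ (b : Fin n) (m : ℤ), g i b = ((ϖ ^ m : Fˣ) : F) ∧ (∀ b', b' ≠ b → g i b' = 0) ∧
    ∀ i', i' ≠ i → g i' b = 0

omit [TopologicalSpace F] [IsNonarchimedeanLocalField F] in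
theorem exists_leftmost_max_valuation (g : GL (Fin n) F) (i : Fin n) :
    ∃ a, g i a ≠ 0 ∧ (∀ b, valuation F (g i b) ≤ valuation F (g i a)) ∧
      ∀ b, b < a → valuation F (g i b) < valuation F (g i a) := by
  obtain ⟨a₀, -, ha₀⟩ := Finset.exists_max_image Finset.univ (fun b => valuation F (g i b))
    ⟨i, Finset.mem_univ _⟩
  obtain ⟨a, ha, hmin⟩ := (Finset.univ.filter fun a =>
    ∀ b, valuation F (g i b) ≤ valuation F (g i a)).exists_minimal
      ⟨a₀, by simpa using fun b => ha₀ b (Finset.mem_univ _)⟩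
  have ha : ∀ b, valuation F (g i b) ≤ valuation F (g i a) := by simpa using ha
  refine ⟨a, fun h0 => ?_, ha, fun b hb => lt_of_le_of_ne (ha b) fun h => ?_⟩
  · have hrow : ∀ b, g i b = 0 := fun b => by
      have := ha b
      rw [h0, map_zero] at this
      simpa using this
    have h1 : (g * g⁻¹) i i = 1 := by simp
    rw [Units.val_mul, Matrix.mul_apply, Finset.sum_eq_zero fun b _ => by rw [hrow, zero_mul]]
      at h1
    exact zero_ne_one h1
  · exact hb.not_ge (hmin (by simpa [h] using ha) hb.le)

/-- The pivot is the leftmost entry of largest absolute value in its row. Clearing the row by column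
operations then uses integral coefficients, lying in the maximal ideal to the left of the pivot,
hence an element of `J`; clearing the column above the pivot uses `N`. -/
theorem exists_isMonomialRow_step (hϖ : IsUnif ϖ) (g : GL (Fin n) F) (i₀ : Fin n)
    (hg : ∀ i, i₀ < i → IsMonomialRow ϖ g i) :
    ∃ ν j : GL (Fin n) F, IsUnipotentUpper ν ∧ j ∈ iwahori n F ∧
      ∀ i, i₀ ≤ i → IsMonomialRow ϖ (ν * g * j) i := by
  obtain ⟨a, ha0, hle, hlt⟩ := exists_leftmost_max_valuation g i₀
  obtain ⟨m, hm⟩ := hϖ.exists_valuation_eq_zpow ha0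
  have hva : 0 < valuation F (g i₀ a) := zero_lt_iff.2 ((Valuation.ne_zero_iff _).2 ha0)
  have hϖm : ((ϖ ^ m : Fˣ) : F) ≠ 0 := Units.ne_zero _
  set y : Fin n → F := fun b =>
    if b = a then ((ϖ ^ m : Fˣ) : F) / g i₀ a else -g i₀ b / g i₀ a with hy
  have hya : y a = ((ϖ ^ m : Fˣ) : F) / g i₀ a := if_pos rfl
  have hyb : ∀ b, b ≠ a → y b = -g i₀ b / g i₀ a := fun b hb => if_neg hb
  have hya0 : y a ≠ 0 := by
    rw [hya]
    exact div_ne_zero hϖm ha0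
  have hvya : valuation F (y a) = 1 := by
    rw [hya, map_div₀, ← hm, div_self hva.ne']
  have hj : rowElt a y hya0 ∈ iwahori n F := by
    rw [mem_iwahori_iff]
    refine ⟨fun p q => ?_, fun p q hpq => ?_, fun p => ?_⟩
    · rw [rowElt_apply]
      by_cases hp : p = a
      · rw [if_pos hp]
        by_cases hq : q = a
        · rw [hq, hvya]
        · rw [hyb q hq, map_div₀, Valuation.map_neg]
          exact (div_le_one₀ hva).2 (hle q)
      · rw [if_neg hp]
        split_ifs <;> simp
    · rw [rowElt_apply]
      by_cases hp : p = a
      · subst hp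
        rw [if_pos rfl, hyb q hpq.ne, map_div₀, Valuation.map_neg]
        exact (div_lt_one₀ hva).2 (hlt q hpq)
      · rw [if_neg hp, if_neg hpq.ne']
        simp
    · rw [rowElt_apply]
      by_cases hp : p = a
      · rw [if_pos hp, hp, hvya]
      · rw [if_neg hp, if_pos rfl, map_one]
  set h := g * rowElt a y hya0 with hh
  have hha : h i₀ a = ((ϖ ^ m : Fˣ) : F) := by
    rw [hh, mul_rowElt_apply, if_pos rfl, hya, zero_add, mul_div_cancel₀ _ ha0]
  have hhb : ∀ b, b ≠ a → h i₀ b = 0 := fun b hb => by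
    rw [hh, mul_rowElt_apply, if_neg hb, hyb b hb]
    field_simp
    ring
  -- A finished lower row cannot have its nonzero entry in the pivot column, since that column is
  -- nonzero at `i₀`. So neither operation disturbs the finished rows.
  have hga : ∀ i, i₀ < i → g i a = 0 := fun i hi => by
    obtain ⟨b, _, -, hb, hb'⟩ := hg i hi
    refine hb a ?_
    rintro rfl
    exact ha0 (hb' i₀ hi.ne)
  have hrow : ∀ i, i₀ < i → ∀ b, h i b = g i b := fun i hi b => by
    rw [hh, mul_rowElt_apply, hga i hi, zero_mul, add_zero]
    split_ifs with hb
    · rw [hb, hga i hi]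
    · rfl
  set z : Fin n → F := fun p => if p = i₀ then 1 else -h p a / ((ϖ ^ m : Fˣ) : F) with hz
  have hzi : z i₀ = 1 := if_pos rfl
  have hzp : ∀ p, p ≠ i₀ → z p = -h p a / ((ϖ ^ m : Fˣ) : F) := fun p hp => if_neg hp
  have hzlow : ∀ p, i₀ < p → z p = 0 := fun p hp => by
    rw [hzp p hp.ne', hrow p hp, hga p hp, neg_zero, zero_div]
  have hz0 : z i₀ ≠ 0 := by simp [hzi]
  refine ⟨colElt i₀ z hz0, rowElt a y hya0, ⟨fun p q hpq => ?_, fun p => ?_⟩, hj, fun i hi => ?_⟩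
  · rw [colElt_apply]
    by_cases hq : q = i₀
    · rw [if_pos hq, hzlow p (hq ▸ hpq)]
    · rw [if_neg hq, if_neg hpq.ne']
  · rw [colElt_apply]
    by_cases hp : p = i₀
    · rw [if_pos hp, hp, hzi]
    · rw [if_neg hp, if_pos rfl]
  rw [mul_assoc, ← hh]
  have hM0 : ∀ b, (colElt i₀ z hz0 * h) i₀ b = h i₀ b := fun b => by
    rw [colElt_mul_apply, if_pos rfl, hzi, one_mul, zero_add]
  rcases hi.eq_or_lt with rfl | hi
  · refine ⟨a, m, by rw [hM0, hha], fun b hb => by rw [hM0, hhb b hb], fun p hp => ?_⟩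
    rw [colElt_mul_apply, if_neg hp, hha, hzp p hp, div_mul_cancel₀ _ hϖm, add_neg_cancel]
  · obtain ⟨b, l, hb1, hb2, hb3⟩ := hg i hi
    have hMi : ∀ b, (colElt i₀ z hz0 * h) i b = g i b := fun b => by
      rw [colElt_mul_apply, if_neg hi.ne', hzlow i hi, zero_mul, add_zero, hrow i hi]
    have hba : b ≠ a := by
      rintro rfl
      exact ha0 (hb3 i₀ hi.ne)
    refine ⟨b, l, by rw [hMi, hb1], fun b' hb' => by rw [hMi, hb2 b' hb'], fun p hp => ?_⟩
    rw [colElt_mul_apply, hhb b hba, mul_zero, add_zero]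
    split_ifs with hp0
    · rfl
    · rw [hh, mul_rowElt_apply, if_neg hba, hb3 p hp, hyb b hba, hb3 i₀ hi.ne]
      simp

theorem exists_forall_isMonomialRow (hϖ : IsUnif ϖ) (g : GL (Fin n) F) :
    ∃ ν j : GL (Fin n) F, IsUnipotentUpper ν ∧ j ∈ iwahori n F ∧
      ∀ i, IsMonomialRow ϖ (ν * g * j) i := by
  -- Rows are treated from the bottom up, because `N` can only clear entries above a pivot.
  have key : ∀ r : ℕ, r ≤ n → ∃ ν j : GL (Fin n) F, IsUnipotentUpper ν ∧ j ∈ iwahori n F ∧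
      ∀ i : Fin n, r ≤ i → IsMonomialRow ϖ (ν * g * j) i := by
    intro r hr
    induction hr using Nat.decreasingInduction with
    | self => exact ⟨1, 1, isUnipotentUpper_one, one_mem _, fun i hi => absurd i.2 hi.not_gt⟩
    | of_succ r hr ih =>
      obtain ⟨ν, j, hν, hj, h⟩ := ih
      obtain ⟨ν', j', hν', hj', h'⟩ := exists_isMonomialRow_step hϖ (ν * g * j) ⟨r, hr⟩
        fun i hi => h i (Fin.lt_def.1 hi)
      refine ⟨ν' * ν, j * j', hν'.mul hν, mul_mem hj hj', fun i hi => ?_⟩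
      have := h' i (Fin.le_def.2 hi)
      simpa [mul_assoc] using this
  obtain ⟨ν, j, hν, hj, h⟩ := key 0 (Nat.zero_le _)
  exact ⟨ν, j, hν, hj, fun i => h i (Nat.zero_le _)⟩

/-- `G` is the union of the double cosets `N ϖ^k w J`. -/
theorem exists_eq_mul_unifPow_mul_weylElt_mul (hϖ : IsUnif ϖ) (g : GL (Fin n) F) :
    ∃ (ν : GL (Fin n) F) (k : Fin n → ℤ) (w : Equiv.Perm (Fin n)) (j : GL (Fin n) F),
      IsUnipotentUpper ν ∧ j ∈ iwahori n F ∧ g = ν * unifPow ϖ k * weylElt F w * j := by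
  obtain ⟨ν, j, hν, hj, h⟩ := exists_forall_isMonomialRow hϖ g
  choose σ k h1 h2 h3 using h
  have hinj : Function.Injective σ := by
    intro i i' hii
    by_contra hne
    have := h3 i i' (Ne.symm hne)
    rw [hii, h1 i'] at this
    exact Units.ne_zero _ this
  let w : Equiv.Perm (Fin n) := Equiv.ofBijective σ (Finite.injective_iff_bijective.1 hinj)
  have hM : ν * g * j = unifPow ϖ k * weylElt F w⁻¹ := by
    ext i b
    rw [unifPow_mul_apply, weylElt_apply]
    have hiff : i = w⁻¹ b ↔ b = σ i := by
      rw [Equiv.Perm.eq_inv_iff_eq, eq_comm]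
      rfl
    by_cases hb : b = σ i
    · rw [if_pos (hiff.2 hb), hb, h1, mul_one]
    · rw [if_neg (fun h => hb (hiff.1 h)), h2 i b hb, mul_zero]
  refine ⟨ν⁻¹, k, w⁻¹, j⁻¹, hν.inv, inv_mem hj, ?_⟩
  rw [mul_assoc ν⁻¹, ← hM]
  group

end Decomposition

end IwahoriWhittaker

/-! ### The theorem. -/

theorem theorem4p2 {F : Type*} [Field F] [ValuativeRel F] [TopologicalSpace F]
    [IsNonarchimedeanLocalField F] (n : ℕ) (hn : 1 ≤ n)
    [MeasurableSpace (GL (Fin n) F)] [BorelSpace (GL (Fin n) F)]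
    (μ : Measure (GL (Fin n) F)) [μ.IsHaarMeasure]
    (hμ : μ (IwahoriWhittaker.iwahori n F : Set (GL (Fin n) F)) = 1)
    (ϖ : Fˣ) (hϖ : IwahoriWhittaker.IsUnif ϖ)
    (ψ : AddChar F ℂ) (hψ : IwahoriWhittaker.IsUnramifiedChar ϖ ψ)
    (ε : ℂ) (W : GL (Fin n) F → ℂ)
    (hW : IwahoriWhittaker.IsSteinbergWhittaker μ ϖ ψ ε W) :
    (∀ (k : Fin n → ℤ) (w : Equiv.Perm (Fin n)),
      (IwahoriWhittaker.IsDominant w k →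
        W (IwahoriWhittaker.unifPow ϖ k * IwahoriWhittaker.weylElt F w) =
          ε ^ (∑ i, k i) * (-1 : ℂ) ^ (((n : ℤ) - 1) * ∑ i, k i) *
            (IwahoriWhittaker.deltaB (fun i => ϖ ^ k i) : ℂ) *
            (-(IwahoriWhittaker.resCard F : ℂ)) ^
              (-(IwahoriWhittaker.weylLength w : ℤ))) ∧
      (¬ IwahoriWhittaker.IsDominant w k →
        W (IwahoriWhittaker.unifPow ϖ k * IwahoriWhittaker.weylElt F w) = 0)) ∧
    (∀ g : GL (Fin n) F, ∃ (ν : GL (Fin n) F) (k : Fin n → ℤ) (w : Equiv.Perm (Fin n))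
      (j : GL (Fin n) F), IwahoriWhittaker.IsUnipotentUpper ν ∧
        j ∈ IwahoriWhittaker.iwahori n F ∧
        g = ν * IwahoriWhittaker.unifPow ϖ k * IwahoriWhittaker.weylElt F w * j) ∧
    (∀ W' : GL (Fin n) F → ℂ, IwahoriWhittaker.IsSteinbergWhittaker μ ϖ ψ ε W' → W' = W) := by
  obtain ⟨N, rfl⟩ : ∃ N, n = N + 1 := ⟨n - 1, by omega⟩
  refine ⟨fun k w => ⟨fun hk => hW.eq_dominantValue hμ hϖ hψ hk,
      fun hk => hW.eq_zero_of_not_isDominant hϖ hψ hk⟩,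
    IwahoriWhittaker.exists_eq_mul_unifPow_mul_weylElt_mul hϖ, fun W' hW' => funext fun g => ?_⟩
  obtain ⟨ν, k, w, j, hν, hj, rfl⟩ :=
    IwahoriWhittaker.exists_eq_mul_unifPow_mul_weylElt_mul hϖ g
  rw [hW.iwahori_inv _ j hj, hW'.iwahori_inv _ j hj, mul_assoc, hW.whittaker _ _ hν,
    hW'.whittaker _ _ hν]
  by_cases hk : IwahoriWhittaker.IsDominant w k
  · rw [hW.eq_dominantValue hμ hϖ hψ hk, hW'.eq_dominantValue hμ hϖ hψ hk]
  · rw [hW.eq_zero_of_not_isDominant hϖ hψ hk, hW'.eq_zero_of_not_isDominant hϖ hψ hk]
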